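/- **Setting.** Let $(\bar M,g)$ be a Riemannian manifold with Levi-Civita connection $\bar\nabla$, and let $\varphi$ be a smooth $(1,1)$-tensor field on $\bar M$ with $\varphi^2=-I$, $g(\varphi\cdot,\varphi\cdot)=g$ and $\bar\nabla\varphi=0$, so that $(\bar M,\varphi,g)$ is a Kähler manifold. Let $M$ be a submanifold of $\bar M$ defined by an injective immersion, with the induced metric, also denoted by $g$, and its Levi-Civita connection $\nabla$. (Manifolds are smooth, finite-dimensional, Hausdorff, second countable and without boundary.) Let $h(X,Y)$ be the second fundamental form, i.e. the normal component of $\bar\nabla_XY$ for $X,Y\in\Gamma(TM)$. For $X$ tangent to $M$ let $TX$ be the tangential component of $\varphi X$, and for $V$ normal to $M$ let $nV$ be the normal component of $\varphi V$. Write $\nabla T=0$ if $\nabla_X(TY)=T(\nabla_XY)$ for all $X,Y\in\Gamma(TM)$. Assume that $M$ is pointwise $k$-slant, $k\ge 1$: there are mutually orthogonal smooth distributions $\mathcal D_0,\mathcal D_1,\dots,\mathcal D_k$ of constant rank on $M$ with $TM=\mathcal D_0\oplus\dots\oplus\mathcal D_k$ such that $\varphi(\mathcal D_0)\subseteq\mathcal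 D_0$ ($\mathcal D_0$ may be trivial), and such that for every $i\in\{1,\dots,k\}$ the distribution $\mathcal D_i$ is nontrivial, $T(\mathcal D_i)\subseteq\mathcal D_i$, and at each $p\in M$ the angle $\theta_i(p)$ between $\varphi X$ and $(\mathcal D_i)_p$ is the same for all nonzero $X\in(\mathcal D_i)_p$ and lies in $(0,\frac{\pi}{2}]$, where $\theta_i(p)\ne\theta_j(p)$ for all $p\in M$ and all $i\neq j$ in $\{1,\dots,k\}$. Put $\theta_0=0$. A distribution $\mathcal D$ is called integrable if $[X,Y]\in\Gamma(\mathcal D)$ for all $X,Y\in\Gamma(\mathcal D)$, and completely integrable if $\nabla_XY\in\Gamma(\mathcal D)$ for all $X,Y\in\Gamma(\mathcal D)$. **Theorem.** If $\nabla T=0$, then: (i) $\mathcal D_0$ and $\bigoplus_{i=1}^k\mathcal D_i$ are completely integrable. (ii) For every $i\in\{0,\dots,k\}$ such that $\theta_j(p)\ne\frac{\pi}{2}$ for all $p\in M$ and all $j\in\{0,\dots,k\}$ with $j\neq i$, the distribution $\mathcal D_i$ is integrable if and only if $\nabla_X TY-\nabla_Y TX\in\Gamma(\mathcal D_i)$ for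 all $X,Y\in\Gamma(\mathcal D_i)$. (iii) Either $h(X,Y)=0$ for all $X,Y\in\Gamma(\mathcal D_0)$, or $-1$ is an eigenvalue of $n^2$ at every point of $M$ and, for all $X,Y\in\Gamma(\mathcal D_0)$, $h(X,Y)$ is an eigenvector of $n^2$ for the eigenvalue $-1$ at every point at which it is nonzero. -/

import Mathlib

open Bundle VectorField
open scoped Manifold ContDiff Topology
noncomputable section
set_option linter.unusedSectionVars false

namespace Slant
section LC
variable {E : Type*} [NormedAddCommGroup E] [NormedSpace ℝ E]
  {H : Type*} [TopologicalSpace H] {I : ModelWithCorners ℝ E H}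
  {M : Type*} [TopologicalSpace M] [ChartedSpace H M]
  [RiemannianBundle (fun x : M ↦ TangentSpace I x)]

/-- The Koszul expression
`(X⟨Y,Z⟩ + Y⟨Z,X⟩ - Z⟨X,Y⟩ + ⟨[X,Y],Z⟩ - ⟨[Y,Z],X⟩ + ⟨[Z,X],Y⟩) / 2` at the point `x`. -/
def koszul (X Y Z : Π x : M, TangentSpace I x) (x : M) : ℝ :=
  (mvfderiv I (fun q ↦ inner ℝ (Y q) (Z q)) x (X x)
    + mvfderiv I (fun q ↦ inner ℝ (Z q) (X q)) x (Y x)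
    - mvfderiv I (fun q ↦ inner ℝ (X q) (Y q)) x (Z x)
    + inner ℝ (mlieBracket I X Y x) (Z x)
    - inner ℝ (mlieBracket I Y Z x) (X x)
    + inner ℝ (mlieBracket I Z X x) (Y x)) / 2

variable [FiniteDimensional ℝ E]

instance finiteDimensional_tangentSpace (x : M) : FiniteDimensional ℝ (TangentSpace I x) :=
  inferInstanceAs (FiniteDimensional ℝ E)

variable [IsManifold I ∞ M]
  [IsContMDiffRiemannianBundle I ∞ E (fun x : M ↦ TangentSpace I x)]

lemma mdiffAt_inner {Y Z : Π x : M, TangentSpace I x} {x : M}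
    (hY : MDiffAt (T% Y) x) (hZ : MDiffAt (T% Z) x) :
    MDifferentiableAt I 𝓘(ℝ, ℝ) (fun q ↦ inner ℝ (Y q) (Z q)) x :=
  MDifferentiableAt.inner_bundle (F := E) (E := fun x : M ↦ TangentSpace I x) hY hZ

lemma koszul_tensorial_left {Y Z : Π x : M, TangentSpace I x} {x : M}
    (hY : MDiffAt (T% Y) x) (hZ : MDiffAt (T% Z) x) :
    TensorialAt I E (fun X ↦ koszul X Y Z x) x where
  smul {f X} hf hX := by
    have := FiniteDimensional.complete ℝ E
    simp [koszul, mlieBracket_smul_left hf hX, mlieBracket_smul_right hf hX,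
      inner_add_left, inner_smul_left, inner_smul_right,
      mvfderiv_fun_mul hf (mdiffAt_inner hZ hX), mvfderiv_fun_mul hf (mdiffAt_inner hX hY)]
    rw [real_inner_comm (Z x)]
    ring
  add {X X'} hX hX' := by
    have := FiniteDimensional.complete ℝ E
    simp [koszul, mlieBracket_add_left hX hX', mlieBracket_add_right hX hX',
      inner_add_left, inner_add_right,
      mvfderiv_fun_add (mdiffAt_inner hZ hX) (mdiffAt_inner hZ hX'),
      mvfderiv_fun_add (mdiffAt_inner hX hY) (mdiffAt_inner hX' hY)]
    ring

lemma koszul_tensorial_right {X Y : Π x : M, TangentSpace I x} {x : M}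
    (hX : MDiffAt (T% X) x) (hY : MDiffAt (T% Y) x) :
    TensorialAt I E (fun Z ↦ koszul X Y Z x) x where
  smul {f Z} hf hZ := by
    have := FiniteDimensional.complete ℝ E
    simp [koszul, mlieBracket_smul_left hf hZ, mlieBracket_smul_right hf hZ,
      inner_add_left, inner_smul_left, inner_smul_right,
      mvfderiv_fun_mul hf (mdiffAt_inner hZ hX), mvfderiv_fun_mul hf (mdiffAt_inner hY hZ)]
    rw [real_inner_comm (Z x) (Y x)]
    ring
  add {Z Z'} hZ hZ' := by
    have := FiniteDimensional.complete ℝ E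
    simp [koszul, mlieBracket_add_left hZ hZ', mlieBracket_add_right hZ hZ',
      inner_add_left, inner_add_right,
      mvfderiv_fun_add (mdiffAt_inner hZ hX) (mdiffAt_inner hZ' hX),
      mvfderiv_fun_add (mdiffAt_inner hY hZ) (mdiffAt_inner hY hZ')]
    ring

lemma koszul_add {X Y Y' Z : Π x : M, TangentSpace I x} {x : M}
    (hX : MDiffAt (T% X) x) (hY : MDiffAt (T% Y) x) (hY' : MDiffAt (T% Y') x)
    (hZ : MDiffAt (T% Z) x) :
    koszul X (Y + Y') Z x = koszul X Y Z x + koszul X Y' Z x := by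
  have := FiniteDimensional.complete ℝ E
  simp [koszul, mlieBracket_add_left hY hY', mlieBracket_add_right hY hY',
    inner_add_left, inner_add_right,
    mvfderiv_fun_add (mdiffAt_inner hY hZ) (mdiffAt_inner hY' hZ),
    mvfderiv_fun_add (mdiffAt_inner hX hY) (mdiffAt_inner hX hY')]
  ring

lemma koszul_smul {X Y Z : Π x : M, TangentSpace I x} {x : M} {f : M → ℝ}
    (hf : MDiffAt f x) (hX : MDiffAt (T% X) x) (hY : MDiffAt (T% Y) x)
    (hZ : MDiffAt (T% Z) x) :
    koszul X (f • Y) Z x =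
      f x * koszul X Y Z x + mvfderiv I f x (X x) * inner ℝ (Y x) (Z x) := by
  have := FiniteDimensional.complete ℝ E
  simp [koszul, mlieBracket_smul_left hf hY, mlieBracket_smul_right hf hY,
    inner_add_left, inner_smul_left, inner_smul_right,
    mvfderiv_fun_mul hf (mdiffAt_inner hY hZ), mvfderiv_fun_mul hf (mdiffAt_inner hX hY)]
  rw [real_inner_comm (X x) (Y x)]
  ring

lemma koszul_metric {X Y Z : Π x : M, TangentSpace I x} {x : M} :
    koszul X Y Z x + koszul X Z Y x = mvfderiv I (fun q ↦ inner ℝ (Y q) (Z q)) x (X x) := by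
  simp only [koszul]
  rw [mlieBracket_swap_apply (V := Z) (W := Y), mlieBracket_swap_apply (V := X) (W := Z), mlieBracket_swap_apply (V := Y) (W := X)]
  simp only [real_inner_comm (Y _) (Z _), real_inner_comm (X _) (Y _), real_inner_comm (Z _) (X _), inner_neg_left]
  ring

lemma koszul_torsion {X Y Z : Π x : M, TangentSpace I x} {x : M} :
    koszul X Y Z x - koszul Y X Z x = inner ℝ (mlieBracket I X Y x) (Z x) := by
  simp only [koszul]
  rw [mlieBracket_swap_apply (V := Z) (W := Y), mlieBracket_swap_apply (V := X) (W := Z), mlieBracket_swap_apply (V := Y) (W := X)]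
  simp only [real_inner_comm (Y _) (Z _), real_inner_comm (X _) (Y _), real_inner_comm (Z _) (X _), inner_neg_left]
  ring

open Classical in
variable (I M) in
/-- `leviCivitaFun I M Y x v` is the tangent vector `∇_v Y` at `x` given by the Koszul formula:
`⟨∇_v Y, w⟩` is the Koszul expression at `x` of `X`, `Y`, `Z` for any `X`, `Z` with `X x = v`,
`Z x = w` (see `inner_leviCivitaFun`). The value is `0` where `Y` is not differentiable. -/
def leviCivitaFun (Y : Π x : M, TangentSpace I x) (x : M) :
    TangentSpace I x →L[ℝ] TangentSpace I x :=
  haveI := FiniteDimensional.complete ℝ (TangentSpace I x)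
  if hY : MDiffAt (T% Y) x then
    let B : TangentSpace I x →L[ℝ] TangentSpace I x →L[ℝ] ℝ :=
      TensorialAt.mkHom₂ (F := E) (F' := E) (fun X Z ↦ koszul X Y Z x) x
        (fun _ hZ ↦ koszul_tensorial_left hY hZ)
        (fun _ hX ↦ koszul_tensorial_right hX hY)
    LinearMap.toContinuousLinearMap
      { toFun := fun v ↦ (InnerProductSpace.toDual ℝ (TangentSpace I x)).symm (B v)
        map_add' := by simp
        map_smul' := by simp }
  else 0

lemma inner_leviCivitaFun {X Y Z : Π x : M, TangentSpace I x} {x : M}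
    (hX : MDiffAt (T% X) x) (hY : MDiffAt (T% Y) x) (hZ : MDiffAt (T% Z) x) :
    inner ℝ (leviCivitaFun I M Y x (X x)) (Z x) = koszul X Y Z x := by
  have := FiniteDimensional.complete ℝ (TangentSpace I x)
  rw [leviCivitaFun, dif_pos hY]
  refine Eq.trans ?_ (TensorialAt.mkHom₂_apply (F := E) (F' := E) (x := x)
    (fun _ hZ ↦ koszul_tensorial_left hY hZ) (fun _ hX ↦ koszul_tensorial_right hX hY) hX hZ)
  exact InnerProductSpace.toDual_symm_apply (𝕜 := ℝ) (E := TangentSpace I x)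

lemma ext_inner_mdiff {x : M} {u v : TangentSpace I x →L[ℝ] TangentSpace I x}
    (h : ∀ X Z : Π x : M, TangentSpace I x, MDiffAt (T% X) x → MDiffAt (T% Z) x →
      inner ℝ (u (X x)) (Z x) = inner ℝ (v (X x)) (Z x)) : u = v := by
  ext w
  refine ext_inner_right ℝ fun z ↦ ?_
  simpa using h (FiberBundle.extend E w) (FiberBundle.extend E z)
    (FiberBundle.mdifferentiableAt_extend I E w) (FiberBundle.mdifferentiableAt_extend I E z)

variable (I M) in
/-- The Levi-Civita connection of a Riemannian manifold; `∇_X Y` at `x` is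
`leviCivita I M Y x (X x)`. -/
def leviCivita : CovariantDerivative I E (TangentSpace I : M → Type _) where
  toFun := leviCivitaFun I M
  isCovariantDerivativeOnUniv :=
    { add := fun {Y Y' x} hY hY' _ ↦ ext_inner_mdiff fun X Z hX hZ ↦ by
        simp [inner_leviCivitaFun hX (mdifferentiableAt_add_section hY hY') hZ, inner_add_left,
          inner_leviCivitaFun hX hY hZ, inner_leviCivitaFun hX hY' hZ,
          koszul_add hX hY hY' hZ]
      leibniz := fun {Y g x} hY hg _ ↦ ext_inner_mdiff fun X Z hX hZ ↦ by
        rw [inner_leviCivitaFun hX (hg.smul_section hY) hZ, koszul_smul hg hX hY hZ]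
        simp [inner_add_left, inner_smul_left, inner_leviCivitaFun hX hY hZ] }

/-- The Levi-Civita connection is compatible with the metric. -/
lemma leviCivita_metric {X Y Z : Π x : M, TangentSpace I x} {x : M}
    (hX : MDiffAt (T% X) x) (hY : MDiffAt (T% Y) x) (hZ : MDiffAt (T% Z) x) :
    mvfderiv I (fun q ↦ inner ℝ (Y q) (Z q)) x (X x) =
      inner ℝ (leviCivita I M Y x (X x)) (Z x) + inner ℝ (Y x) (leviCivita I M Z x (X x)) := by
  rw [← koszul_metric, ← inner_leviCivitaFun hX hY hZ, ← inner_leviCivitaFun hX hZ hY,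
    real_inner_comm (Y x)]
  rfl

/-- The Levi-Civita connection is torsion-free. -/
lemma leviCivita_torsion [CompleteSpace E] : (leviCivita I M).torsion = 0 := by
  rw [CovariantDerivative.torsion_eq_zero_iff]
  intro X Y x hX hY
  refine ext_inner_right ℝ fun z ↦ ?_
  have hz := FiberBundle.mdifferentiableAt_extend I E z
  have h1 := inner_leviCivitaFun hX hY hz
  have h2 := inner_leviCivitaFun hY hX hz
  have h3 := koszul_torsion (X := X) (Y := Y) (Z := FiberBundle.extend E z) (x := x)
  simp only [FiberBundle.extend_apply_self] at h1 h2 h3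
  rw [inner_sub_left, ← h3, ← h1, ← h2]
  rfl

end LC

section Along
variable {E : Type*} [NormedAddCommGroup E] [NormedSpace ℝ E]
  {H : Type*} [TopologicalSpace H] {I : ModelWithCorners ℝ E H}
  {M : Type*} [TopologicalSpace M] [ChartedSpace H M]
  {E' : Type*} [NormedAddCommGroup E'] [NormedSpace ℝ E']
  {H' : Type*} [TopologicalSpace H'] {J : ModelWithCorners ℝ E' H'}
  {N : Type*} [TopologicalSpace N] [ChartedSpace H' N] [IsManifold J ∞ N]

/-- The pull-back connection: for a map `f : M → N`, a connection `cov` on `TN` and a section `σ`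
of `f^*TN`, `covAlong I cov f σ p v` is the derivative of `σ` in the direction `v ∈ T_pM`. If `e` is
the local trivialization of `TN` at `f p`, with frame `e_a`, and `σ = ∑ σ^a (e_a ∘ f)`, it is
`∑ v(σ^a) e_a + ∑ σ^a ∇_{df v} e_a`. The first sum is the first summand below, and the second sum is
`∇_{df v}` of the field with constant components `σ^a(p)`, the second summand.
By `covAlong_comp` it is `∇_{df v} Y` whenever `σ` is the restriction of a field `Y` on `N`. -/
def covAlong (I : ModelWithCorners ℝ E H)
    (cov : CovariantDerivative J E' (TangentSpace J : N → Type _)) (f : M → N)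
    (σ : Π p : M, TangentSpace J (f p)) (p : M) :
    TangentSpace I p →L[ℝ] TangentSpace J (f p) :=
  let e := trivializationAt E' (TangentSpace J : N → Type _) (f p)
  (e.symmL ℝ (f p)) ∘L mvfderiv I (fun q ↦ (e ⟨f q, σ q⟩).2) p
    + cov (FiberBundle.extend E' (σ p)) (f p) ∘L mfderiv I J f p

lemma mvfderiv_congr {g g' : M → E'} {x : M} (h : g =ᶠ[𝓝 x] g') :
    mvfderiv I g x = mvfderiv I g' x :=
  ContinuousLinearMap.ext fun v ↦ congrArg (fun L : TangentSpace I x →L[ℝ] E' ↦ L v)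
    (h.mfderiv_eq (I := I) (I' := 𝓘(ℝ, E')))

variable [FiniteDimensional ℝ E']
lemma covAlong_comp (cov : CovariantDerivative J E' (TangentSpace J : N → Type _)) {f : M → N}
    {p : M} (hf : MDifferentiableAt I J f p) {Y : Π x : N, TangentSpace J x}
    (hY : MDiffAt (T% Y) (f p)) :
    covAlong I cov f (fun q ↦ Y (f q)) p = cov Y (f p) ∘L mfderiv I J f p := by
  have := FiniteDimensional.complete ℝ E'
  let e := trivializationAt E' (TangentSpace J : N → Type _) (f p)
  have he : f p ∈ e.baseSet := FiberBundle.mem_baseSet_trivializationAt' _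
  have hs {σ : Π x : N, TangentSpace J x} {x : N} (hx : x ∈ e.baseSet) (h : MDiffAt (T% σ) x) :
      MDifferentiableAt J 𝓘(ℝ, E') (fun q ↦ (e ⟨q, σ q⟩).2) x := by
    exact (e.mdifferentiableAt_section_iff J σ hx).1 h
  let D (σ : Π x : N, TangentSpace J x) (x : N) : TangentSpace J x →L[ℝ] TangentSpace J x :=
    (e.symmL ℝ x) ∘L mvfderiv J (fun q ↦ (e ⟨q, σ q⟩).2) x
  have hD : IsCovariantDerivativeOn E' D e.baseSet := by
    constructor
    · intro σ σ' x hσ hσ' hx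
      have h : (fun q ↦ (e ⟨q, (σ + σ') q⟩).2) =ᶠ[𝓝 x]
          (fun q ↦ (e ⟨q, σ q⟩).2) + (fun q ↦ (e ⟨q, σ' q⟩).2) :=
        Filter.eventuallyEq_of_mem (e.open_baseSet.mem_nhds hx)
          fun q hq ↦ (e.linear ℝ hq).map_add _ _
      ext v
      simp only [D]
      rw [mvfderiv_congr h, mvfderiv_add (hs hx hσ) (hs hx hσ')]
      simp
    · intro σ g x hσ hg hx
      have h : (fun q ↦ (e ⟨q, (g • σ) q⟩).2) =ᶠ[𝓝 x] g • (fun q ↦ (e ⟨q, σ q⟩).2) :=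
        Filter.eventuallyEq_of_mem (e.open_baseSet.mem_nhds hx)
          fun q hq ↦ (e.linear ℝ hq).map_smul _ _
      ext v
      simp only [D]
      rw [mvfderiv_congr h, mvfderiv_smul hg (hs hx hσ)]
      simp only [ContinuousLinearMap.comp_apply, _root_.add_apply,
        _root_.smul_apply, ContinuousLinearMap.smulRight_apply, map_add, map_smul]
      rw [show e.symmL ℝ x (e ⟨x, σ x⟩).2 = σ x from
        (e.symmL_apply (R := ℝ) hx _).trans (e.symm_apply_apply_mk hx (σ x))]
  have h1 := IsCovariantDerivativeOn.difference_apply (x := f p)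
    (cov.isCovariantDerivativeOn (s := e.baseSet)) hD he hY
  have h2 := IsCovariantDerivativeOn.difference_apply (x := f p)
    (cov.isCovariantDerivativeOn (s := e.baseSet)) hD he
    (FiberBundle.mdifferentiableAt_extend J E' (Y (f p)))
  have h3 : D (FiberBundle.extend E' (Y (f p))) (f p) = 0 := by
    have h : (fun q ↦ (e ⟨q, FiberBundle.extend E' (Y (f p)) q⟩).2) =ᶠ[𝓝 (f p)]
        fun _ ↦ (e ⟨f p, Y (f p)⟩).2 :=
      Filter.eventuallyEq_of_mem (e.open_baseSet.mem_nhds he) fun q hq ↦ by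
        rw [FiberBundle.extend, e.apply_mk_symm hq]
    simp only [D]
    rw [mvfderiv_congr h, mvfderiv_const]
    simp
  rw [FiberBundle.extend_apply_self, h1, h3, sub_zero, sub_eq_iff_eq_add'] at h2
  have h4 : mvfderiv I (fun q ↦ (e ⟨f q, Y (f q)⟩).2) p =
      mvfderiv J (fun x ↦ (e ⟨x, Y x⟩).2) (f p) ∘L mfderiv I J f p :=
    mfderiv_comp p (hs he hY) hf
  rw [h2, covAlong]
  rw [h4]
  rfl

end Along

section Submanifold
variable {E : Type*} [NormedAddCommGroup E] [NormedSpace ℝ E] [FiniteDimensional ℝ E]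
  {H : Type*} [TopologicalSpace H] (I : ModelWithCorners ℝ E H)
  (M : Type*) [TopologicalSpace M] [ChartedSpace H M] [IsManifold I ∞ M]
  [RiemannianBundle (fun x : M ↦ TangentSpace I x)]
  [IsContMDiffRiemannianBundle I ∞ E (fun x : M ↦ TangentSpace I x)]
  {E' : Type*} [NormedAddCommGroup E'] [NormedSpace ℝ E'] [FiniteDimensional ℝ E']
  {H' : Type*} [TopologicalSpace H'] (J : ModelWithCorners ℝ E' H')
  (N : Type*) [TopologicalSpace N] [ChartedSpace H' N] [IsManifold J ∞ N]
  [RiemannianBundle (fun x : N ↦ TangentSpace J x)]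
  [IsContMDiffRiemannianBundle J ∞ E' (fun x : N ↦ TangentSpace J x)]

variable {M} in
/-- `X ∈ Γ(TM)`. -/
def IsSmoothVectorField (X : Π p : M, TangentSpace I p) : Prop :=
  ContMDiff I I.tangent ∞ (fun p ↦ (⟨p, X p⟩ : TangentBundle I M))

/-- A distribution: a subspace of each tangent space. -/
abbrev TangentDistribution := Π p : M, Submodule ℝ (TangentSpace I p)

variable {I M} in
/-- `Γ(D)`: the smooth vector fields with values in `D`. -/
def TangentDistribution.sections (D : TangentDistribution I M) : Set (Π p : M, TangentSpace I p) :=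
  {X | IsSmoothVectorField I X ∧ ∀ p, X p ∈ D p}

variable {I M} in
/-- `D` has constant rank `r` and is locally spanned by `r` smooth vector fields. -/
def TangentDistribution.IsSmoothRegular (D : TangentDistribution I M) : Prop :=
  ∃ r : ℕ, ∀ p : M, ∃ U ∈ 𝓝 p, ∃ X : Fin r → Π q : M, TangentSpace I q,
    (∀ j, ContMDiffOn I I.tangent ∞ (fun q ↦ (⟨q, X j q⟩ : TangentBundle I M)) U) ∧
    ∀ q ∈ U, LinearIndependent ℝ (fun j ↦ X j q) ∧
      Submodule.span ℝ (Set.range fun j ↦ X j q) = D q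

variable {I M} in
/-- `[X, Y] ∈ Γ(D)` for all `X, Y ∈ Γ(D)`. (Lie brackets of smooth fields are smooth, so this is a
condition on the values only.) -/
def TangentDistribution.IsIntegrable (D : TangentDistribution I M) : Prop :=
  ∀ X ∈ D.sections, ∀ Y ∈ D.sections, ∀ p, mlieBracket I X Y p ∈ D p

variable {I M} in
/-- `∇_X Y ∈ Γ(D)` for all `X, Y ∈ Γ(D)`, with `∇` the Levi-Civita connection. (`∇_X Y` is smooth
for smooth `X`, `Y`, so this is a condition on the values only.) -/
def TangentDistribution.IsCompletelyIntegrable (D : TangentDistribution I M) : Prop :=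
  ∀ X ∈ D.sections, ∀ Y ∈ D.sections, ∀ p, leviCivita I M Y p (X p) ∈ D p

/-- A smooth `(1,1)`-tensor field `φ` on the Riemannian manifold `N` with `φ² = -I` and
`g(φ·, φ·) = g`. -/
structure AlmostHermitianStructure where
  φ : Π x : N, TangentSpace J x →L[ℝ] TangentSpace J x
  contMDiff : ContMDiff J (J.prod 𝓘(ℝ, E' →L[ℝ] E')) ∞
    (fun x ↦ TotalSpace.mk' (E' →L[ℝ] E')
      (E := fun x : N ↦ TangentSpace J x →L[ℝ] TangentSpace J x) x (φ x))
  sq : ∀ (x : N) (v : TangentSpace J x), φ x (φ x v) = -v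
  inner_map : ∀ (x : N) (v w : TangentSpace J x), inner ℝ (φ x v) (φ x w) = inner ℝ v w

variable {J N} in
/-- `∇φ = 0`, i.e. `∇_X (φ Y) = φ (∇_X Y)`, for the Levi-Civita connection of `N`. -/
def AlmostHermitianStructure.IsKahler (S : AlmostHermitianStructure J N) : Prop :=
  ∀ X Y : Π x : N, TangentSpace J x, IsSmoothVectorField J X → IsSmoothVectorField J Y →
    ∀ x, leviCivita J N (fun y ↦ S.φ y (Y y)) x (X x) = S.φ x (leviCivita J N Y x (X x))

/-- A submanifold of `N` defined by an injective immersion `M → N`, where `M` carries the induced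
metric. -/
structure RiemannianSubmanifold where
  toFun : M → N
  injective : Function.Injective toFun
  isImmersion : Manifold.IsImmersion I J ∞ toFun
  isometric : ∀ (p : M) (u v : TangentSpace I p),
    inner ℝ (mfderiv I J toFun p u) (mfderiv I J toFun p v) = inner ℝ u v

namespace RiemannianSubmanifold
variable {I J M N} (f : RiemannianSubmanifold I M J N)

/-- The differential of the immersion, as a linear isometry. -/
def d (p : M) : TangentSpace I p →ₗᵢ[ℝ] TangentSpace J (f.toFun p) :=
  (mfderiv I J f.toFun p).toLinearMap.isometryOfInner (f.isometric p)

/-- `T_pM`, as a subspace of the tangent space of `N`. -/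
def tangentImage (p : M) : Submodule ℝ (TangentSpace J (f.toFun p)) :=
  LinearMap.range (f.d p).toLinearMap

/-- The normal space of the submanifold at `p`. -/
def normalSpace (p : M) : Submodule ℝ (TangentSpace J (f.toFun p)) := (f.tangentImage p)ᗮ

/-- The tangential component of `w`: the `u ∈ T_pM` such that `df u` is the orthogonal projection
of `w` to `df (T_pM)`. -/
def tangentialPart (p : M) : TangentSpace J (f.toFun p) →ₗ[ℝ] TangentSpace I p :=
  (f.d p).equivRange.symm.toLinearEquiv.toLinearMap ∘ₗ
    ((f.tangentImage p).orthogonalProjectionOnto).toLinearMap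

/-- The normal component. -/
def normalPart (p : M) : TangentSpace J (f.toFun p) →ₗ[ℝ] f.normalSpace p :=
  ((f.normalSpace p).orthogonalProjectionOnto).toLinearMap

lemma tangentialPart_add_normalPart (p : M) (w : TangentSpace J (f.toFun p)) :
    f.d p (f.tangentialPart p w) + f.normalPart p w = w := by
  have h1 : f.d p (f.tangentialPart p w) = (f.tangentImage p).starProjection w :=
    congrArg Subtype.val ((f.d p).equivRange.apply_symm_apply
      ((f.tangentImage p).orthogonalProjectionOnto w))
  rw [h1]
  exact Submodule.starProjection_add_starProjection_orthogonal (K := f.tangentImage p) w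

variable (S : AlmostHermitianStructure J N)

/-- `TX`, the tangential component of `φX`, for `X` tangent to `M`. -/
def T (p : M) : TangentSpace I p →ₗ[ℝ] TangentSpace I p :=
  f.tangentialPart p ∘ₗ (S.φ (f.toFun p)).toLinearMap ∘ₗ (f.d p).toLinearMap

/-- `nV`, the normal component of `φV`, for `V` normal to `M`. -/
def n (p : M) : Module.End ℝ (f.normalSpace p) :=
  f.normalPart p ∘ₗ (S.φ (f.toFun p)).toLinearMap ∘ₗ (f.normalSpace p).subtype

/-- The second fundamental form: the normal component of the derivative of `Y` in the direction `X`
with respect to the Levi-Civita connection of `N`. -/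
def h (X Y : Π p : M, TangentSpace I p) (p : M) : f.normalSpace p :=
  f.normalPart p (covAlong I (leviCivita J N) f.toFun (fun q ↦ f.d q (Y q)) p (X p))

/-- `∇T = 0`, i.e. `∇_X (TY) = T (∇_X Y)`. -/
def IsParallelT : Prop :=
  ∀ X Y : Π p : M, TangentSpace I p, IsSmoothVectorField I X → IsSmoothVectorField I Y →
    ∀ p, leviCivita I M (fun q ↦ f.T S q (Y q)) p (X p) = f.T S p (leviCivita I M Y p (X p))

/-- The angle between `φu` and `D_p ⊆ T_pM`, i.e. between `φu` and its orthogonal projection to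
`D_p` (it is `π / 2` if this projection is `0`). -/
def angleTo (D : TangentDistribution I M) (p : M) (u : TangentSpace I p) : ℝ :=
  InnerProductGeometry.angle (S.φ (f.toFun p) (f.d p u))
    (((D p).map (f.d p).toLinearMap).starProjection (S.φ (f.toFun p) (f.d p u)))

/-- The submanifold is pointwise `k`-slant, with distributions `D 0, …, D k` and slant functions
`θ 1, …, θ k` (and `θ 0 = 0` by convention). -/
structure IsPointwiseSlant (k : ℕ) (D : Fin (k + 1) → TangentDistribution I M)
    (θ : Fin (k + 1) → M → ℝ) : Prop where
  one_le : 1 ≤ k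
  smooth_regular : ∀ i, (D i).IsSmoothRegular
  orthogonal : ∀ i j, i ≠ j → ∀ p, ∀ u ∈ D i p, ∀ v ∈ D j p, inner ℝ u v = 0
  direct_sum : ∀ p, DirectSum.IsInternal (fun i ↦ D i p)
  T_mem : ∀ i, i ≠ 0 → ∀ p, ∀ u ∈ D i p, f.T S p u ∈ D i p
  invariant : ∀ p, ∀ u ∈ D 0 p,
    S.φ (f.toFun p) (f.d p u) ∈ (D 0 p).map (f.d p).toLinearMap
  nontrivial : ∀ i, i ≠ 0 → ∀ p, D i p ≠ ⊥
  slant : ∀ i, i ≠ 0 → ∀ p, ∀ u ∈ D i p, u ≠ 0 → f.angleTo S (D i) p u = θ i p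
  theta_mem : ∀ i, i ≠ 0 → ∀ p, θ i p ∈ Set.Ioc 0 (Real.pi / 2)
  theta_zero : ∀ p, θ 0 p = 0
  theta_ne : ∀ i j, i ≠ 0 → j ≠ 0 → i ≠ j → ∀ p, θ i p ≠ θ j p

end RiemannianSubmanifold
end Submanifold
end Slant

end

open Slant

noncomputable section
set_option linter.unusedSectionVars false

namespace Slant

section VectorFields
variable {E : Type*} [NormedAddCommGroup E] [NormedSpace ℝ E] [FiniteDimensional ℝ E]
  {M : Type*} [TopologicalSpace M] [ChartedSpace E M] [IsManifold 𝓘(ℝ, E) ∞ M]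

/-- A vector field that is smooth near `p` agrees near `p` with a global smooth vector field which
is everywhere a multiple of it and vanishes outside the given neighbourhood. -/
lemma exists_isSmoothVectorField_eventuallyEq [T2Space M] {p : M} {U : Set M} (hU : U ∈ 𝓝 p)
    {σ : Π q : M, TangentSpace 𝓘(ℝ, E) q}
    (hσ : ContMDiffOn 𝓘(ℝ, E) 𝓘(ℝ, E).tangent ∞
      (fun q ↦ (⟨q, σ q⟩ : TangentBundle 𝓘(ℝ, E) M)) U) :
    ∃ Z : Π q : M, TangentSpace 𝓘(ℝ, E) q, IsSmoothVectorField 𝓘(ℝ, E) Z ∧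
      (∀ᶠ q in 𝓝 p, Z q = σ q) ∧ ∀ q, ∃ c : ℝ, Z q = c • σ q ∧ (q ∉ U → c = 0) := by
  obtain ⟨V, hVU, hV, hpV⟩ := mem_nhds_iff.1 hU
  obtain ⟨ψ, -, hψ⟩ := ((SmoothBumpFunction.nhds_basis_tsupport (I := 𝓘(ℝ, E)) p).mem_iff).1
    (hV.mem_nhds hpV)
  refine ⟨(ψ : M → ℝ) • σ, ContMDiffOn.smul_section_of_tsupport ψ.contMDiff.contMDiffOn hV hψ
    (hσ.mono hVU), ?_, fun q ↦ ⟨ψ q, rfl, fun hq ↦ ?_⟩⟩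
  · filter_upwards [ψ.eventuallyEq_one] with q hq
    simp [hq]
  · exact image_eq_zero_of_notMem_tsupport fun h ↦ hq (hVU (hψ h))

lemma IsSmoothVectorField.mdiffAt {X : Π q : M, TangentSpace 𝓘(ℝ, E) q}
    (hX : IsSmoothVectorField 𝓘(ℝ, E) X) (p : M) : MDiffAt (T% X) p :=
  (hX p).mdifferentiableAt (by simp)

/-- Each vector of a regular distribution is the value of a section. -/
lemma TangentDistribution.IsSmoothRegular.exists_section [T2Space M]
    {D : TangentDistribution 𝓘(ℝ, E) M} (hD : D.IsSmoothRegular) {p : M}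
    {v : TangentSpace 𝓘(ℝ, E) p} (hv : v ∈ D p) : ∃ Z ∈ D.sections, Z p = v := by
  obtain ⟨r, hr⟩ := hD
  obtain ⟨U, hU, X, hX, hspan⟩ := hr p
  have hpU := mem_of_mem_nhds hU
  rw [← (hspan p hpU).2, Submodule.mem_span_range_iff_exists_fun] at hv
  obtain ⟨c, rfl⟩ := hv
  have hs : ContMDiffOn 𝓘(ℝ, E) 𝓘(ℝ, E).tangent ∞
      (fun q ↦ (⟨q, ∑ j, c j • X j q⟩ : TangentBundle 𝓘(ℝ, E) M)) U :=
    ContMDiffOn.sum_section fun j _ ↦ (contMDiffOn_const (c := c j)).smul_section (hX j)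
  obtain ⟨Z, hZ, hZσ, hZc⟩ := exists_isSmoothVectorField_eventuallyEq hU hs
  refine ⟨Z, ⟨hZ, fun q ↦ ?_⟩, hZσ.self_of_nhds⟩
  obtain ⟨a, ha, ha0⟩ := hZc q
  by_cases hq : q ∈ U
  · rw [ha, ← (hspan q hq).2]
    exact Submodule.smul_mem _ _ (Submodule.sum_mem _ fun j _ ↦
      Submodule.smul_mem _ _ (Submodule.subset_span ⟨j, rfl⟩))
  · rw [ha, ha0 hq, zero_smul]
    exact zero_mem _

lemma TangentDistribution.IsSmoothRegular.exists_finrank_eq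
    {D : TangentDistribution 𝓘(ℝ, E) M} (hD : D.IsSmoothRegular) :
    ∃ r : ℕ, ∀ p, Module.finrank ℝ (D p) = r := by
  obtain ⟨r, hr⟩ := hD
  refine ⟨r, fun p ↦ ?_⟩
  obtain ⟨U, hU, X, -, hspan⟩ := hr p
  have h := hspan p (mem_of_mem_nhds hU)
  rw [← h.2, finrank_span_eq_card h.1, Fintype.card_fin]

variable {G : Type*} [NormedAddCommGroup G] [NormedSpace ℝ G]

lemma mvfderiv_apply_eq_fderiv {F : M → G} {p q : M} (hq : q ∈ (extChartAt 𝓘(ℝ, E) p).source)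
    (hF : MDifferentiableAt 𝓘(ℝ, E) 𝓘(ℝ, G) F q) (Y : Π q : M, TangentSpace 𝓘(ℝ, E) q) :
    mvfderiv 𝓘(ℝ, E) F q (Y q) =
      fderiv ℝ (F ∘ (extChartAt 𝓘(ℝ, E) p).symm) (extChartAt 𝓘(ℝ, E) p q)
        (mpullbackWithin 𝓘(ℝ, E) 𝓘(ℝ, E) (extChartAt 𝓘(ℝ, E) p).symm Y (Set.range 𝓘(ℝ, E))
          (extChartAt 𝓘(ℝ, E) p q)) := by
  have hφ := (extChartAt 𝓘(ℝ, E) p).map_source hq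
  have h1 : mpullbackWithin 𝓘(ℝ, E) 𝓘(ℝ, E) (extChartAt 𝓘(ℝ, E) p).symm Y (Set.range 𝓘(ℝ, E))
      (extChartAt 𝓘(ℝ, E) p q) = mfderiv 𝓘(ℝ, E) 𝓘(ℝ, E) (extChartAt 𝓘(ℝ, E) p) q (Y q) := by
    rw [mpullbackWithin_apply, (extChartAt 𝓘(ℝ, E) p).left_inv hq]
    rw [ContinuousLinearMap.inverse_eq
      (mfderivWithin_extChartAt_symm_comp_mfderiv_extChartAt' hq)
      (mfderiv_extChartAt_comp_mfderivWithin_extChartAt_symm' hq)]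
  have h2 : F =ᶠ[𝓝 q] (F ∘ (extChartAt 𝓘(ℝ, E) p).symm) ∘ extChartAt 𝓘(ℝ, E) p := by
    filter_upwards [extChartAt_source_mem_nhds' hq] with x hx
    exact congrArg F ((extChartAt 𝓘(ℝ, E) p).left_inv hx).symm
  have h3 : MDifferentiableAt 𝓘(ℝ, E) 𝓘(ℝ, G) (F ∘ (extChartAt 𝓘(ℝ, E) p).symm)
      (extChartAt 𝓘(ℝ, E) p q) := by
    refine MDifferentiableAt.comp _ (I' := 𝓘(ℝ, E)) ?_ ?_
    · rwa [(extChartAt 𝓘(ℝ, E) p).left_inv hq]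
    · rw [← mdifferentiableWithinAt_univ, ← 𝓘(ℝ, E).range_eq_univ]
      exact mdifferentiableWithinAt_extChartAt_symm hφ
  have h4 := mfderiv_comp q h3 (mdifferentiableAt_extChartAt (by simpa using hq))
  rw [h1, mvfderiv_congr h2]
  change mfderiv _ _ _ _ _ = _
  rw [h4, mfderiv_eq_fderiv]
  rfl

/-- The Lie bracket acts on vector valued functions as a commutator of derivations. -/
lemma mvfderiv_mlieBracket {F : M → G} {p : M} (hF : ContMDiffAt 𝓘(ℝ, E) 𝓘(ℝ, G) ∞ F p)
    {X Y : Π q : M, TangentSpace 𝓘(ℝ, E) q} (hX : MDiffAt (T% X) p) (hY : MDiffAt (T% Y) p) :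
    mvfderiv 𝓘(ℝ, E) F p (mlieBracket 𝓘(ℝ, E) X Y p) =
      mvfderiv 𝓘(ℝ, E) (fun q ↦ mvfderiv 𝓘(ℝ, E) F q (Y q)) p (X p)
        - mvfderiv 𝓘(ℝ, E) (fun q ↦ mvfderiv 𝓘(ℝ, E) F q (X q)) p (Y p) := by
  have := FiniteDimensional.complete ℝ E
  let φ := extChartAt 𝓘(ℝ, E) p
  let C (Y : Π q : M, TangentSpace 𝓘(ℝ, E) q) : E → E :=
    mpullbackWithin 𝓘(ℝ, E) 𝓘(ℝ, E) φ.symm Y (Set.range 𝓘(ℝ, E))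
  have hp : p ∈ φ.source := mem_extChartAt_source p
  have hG : ContDiffAt ℝ ∞ (F ∘ φ.symm) (φ p) := by
    have h := (contMDiffAt_iff.1 hF).2
    rwa [𝓘(ℝ, E).range_eq_univ, contDiffWithinAt_univ] at h
  have hG' : DifferentiableAt ℝ (fderiv ℝ (F ∘ φ.symm)) (φ p) :=
    (hG.fderiv_right (m := 1) (by exact ENat.LEInfty.out (m := 2))).differentiableAt one_ne_zero
  have hC {Y : Π q : M, TangentSpace 𝓘(ℝ, E) q} (hY : MDiffAt (T% Y) p) :
      DifferentiableAt ℝ (C Y) (φ p) := by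
    have h : DifferentiableWithinAt ℝ (C Y) (φ.symm ⁻¹' Set.univ ∩ Set.range 𝓘(ℝ, E)) (φ p) :=
      MDifferentiableWithinAt.differentiableWithinAt_mpullbackWithin_vectorField
        (by rwa [mdifferentiableWithinAt_univ])
    rwa [Set.preimage_univ, Set.univ_inter, 𝓘(ℝ, E).range_eq_univ,
      differentiableWithinAt_univ] at h
  have hnear : ∀ᶠ q in 𝓝 p, q ∈ φ.source ∧ MDifferentiableAt 𝓘(ℝ, E) 𝓘(ℝ, G) F q := by
    refine Filter.Eventually.and (extChartAt_source_mem_nhds p) ?_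
    have h1 : ContMDiffAt 𝓘(ℝ, E) 𝓘(ℝ, G) 1 F p := hF.of_le (by simp)
    filter_upwards [(contMDiffAt_iff_contMDiffAt_nhds (by simp)).1 h1] with q hq
    exact hq.mdifferentiableAt one_ne_zero
  have key {X Y : Π q : M, TangentSpace 𝓘(ℝ, E) q} (hY : MDiffAt (T% Y) p) :
      mvfderiv 𝓘(ℝ, E) (fun q ↦ mvfderiv 𝓘(ℝ, E) F q (Y q)) p (X p) =
        fderiv ℝ (fderiv ℝ (F ∘ φ.symm)) (φ p) (C X (φ p)) (C Y (φ p)) +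
          fderiv ℝ (F ∘ φ.symm) (φ p) (fderiv ℝ (C Y) (φ p) (C X (φ p))) := by
    let K : E → G := fun z ↦ fderiv ℝ (F ∘ φ.symm) z (C Y z)
    have hK : (fun q ↦ mvfderiv 𝓘(ℝ, E) F q (Y q)) =ᶠ[𝓝 p] K ∘ φ := by
      filter_upwards [hnear] with q hq
      exact mvfderiv_apply_eq_fderiv hq.1 hq.2 Y
    have hKd : DifferentiableAt ℝ K (φ p) := hG'.clm_apply (hC hY)
    rw [mvfderiv_congr hK]
    have hKφ : MDifferentiableAt 𝓘(ℝ, E) 𝓘(ℝ, G) (K ∘ φ) p :=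
      MDifferentiableAt.comp p hKd.mdifferentiableAt (mdifferentiableAt_extChartAt (by simp))
    rw [mvfderiv_apply_eq_fderiv hp hKφ X]
    have hKK : (K ∘ φ) ∘ φ.symm =ᶠ[𝓝 (φ p)] K := by
      filter_upwards [extChartAt_target_mem_nhds p] with z hz
      exact congrArg K (φ.right_inv hz)
    change fderiv ℝ ((K ∘ φ) ∘ φ.symm) (φ p) (C X (φ p)) = _
    rw [hKK.fderiv_eq, fderiv_clm_apply hG' (hC hY)]
    simp [add_comm]
  have hsymm : IsSymmSndFDerivAt ℝ (F ∘ φ.symm) (φ p) := hG.isSymmSndFDerivAt (by simpa using ENat.LEInfty.out (m := 2))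
  have hbr : C (mlieBracket 𝓘(ℝ, E) X Y) (φ p) = lieBracket ℝ (C X) (C Y) (φ p) := by
    let L : E →L[ℝ] E := mfderiv 𝓘(ℝ, E) 𝓘(ℝ, E) φ p
    let L' : E →L[ℝ] E := mfderivWithin 𝓘(ℝ, E) 𝓘(ℝ, E) φ.symm (Set.range 𝓘(ℝ, E)) (φ p)
    have hL : L = ContinuousLinearMap.id ℝ E := mfderiv_extChartAt_self
    have hL' : L' = ContinuousLinearMap.id ℝ E := mfderivWithin_range_extChartAt_symm
    have h1 : mlieBracket 𝓘(ℝ, E) X Y p = L.inverse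
        (lieBracketWithin ℝ (C X) (C Y) (φ.symm ⁻¹' Set.univ ∩ Set.range 𝓘(ℝ, E)) (φ p)) := rfl
    have h2 : C (mlieBracket 𝓘(ℝ, E) X Y) (φ p) =
        L'.inverse (mlieBracket 𝓘(ℝ, E) X Y (φ.symm (φ p))) := rfl
    rw [h2, φ.left_inv hp, h1, hL, hL', ContinuousLinearMap.inverse_id, Set.preimage_univ,
      Set.univ_inter, 𝓘(ℝ, E).range_eq_univ, lieBracketWithin_univ]
    rfl
  rw [key hX, key hY, mvfderiv_apply_eq_fderiv hp (hnear.self_of_nhds).2]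
  change fderiv ℝ (F ∘ φ.symm) (φ p) (C (mlieBracket 𝓘(ℝ, E) X Y) (φ p)) = _
  rw [hbr, lieBracket_eq, map_sub, hsymm (C Y (φ p)) (C X (φ p))]
  abel

end VectorFields
end Slant

namespace Slant

section SectionsAlong
variable {E : Type*} [NormedAddCommGroup E] [NormedSpace ℝ E] [FiniteDimensional ℝ E]
  {M : Type*} [TopologicalSpace M] [ChartedSpace E M] [IsManifold 𝓘(ℝ, E) ∞ M]
  {E' : Type*} [NormedAddCommGroup E'] [NormedSpace ℝ E'] [FiniteDimensional ℝ E']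
  {N : Type*} [TopologicalSpace N] [ChartedSpace E' N] [IsManifold 𝓘(ℝ, E') ∞ N]

/-- Differentiability at `p` of a section of `f^*TN`. -/
def MDiffAlongAt (f : M → N) (σ : Π q : M, TangentSpace 𝓘(ℝ, E') (f q)) (p : M) : Prop :=
  MDifferentiableAt 𝓘(ℝ, E) 𝓘(ℝ, E').tangent
    (fun q ↦ (⟨f q, σ q⟩ : TangentBundle 𝓘(ℝ, E') N)) p

variable {f : M → N} {p : M} {σ τ : Π q : M, TangentSpace 𝓘(ℝ, E') (f q)}

lemma mdiffAlongAt_iff (hf : MDifferentiableAt 𝓘(ℝ, E) 𝓘(ℝ, E') f p) :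
    MDiffAlongAt (E := E) f σ p ↔ MDifferentiableAt 𝓘(ℝ, E) 𝓘(ℝ, E')
      (fun q ↦ (trivializationAt E' (TangentSpace 𝓘(ℝ, E') : N → Type _) (f p) ⟨f q, σ q⟩).2) p :=
  (mdifferentiableAt_totalSpace _ (F := E') (E := fun x : N ↦ TangentSpace 𝓘(ℝ, E') x) _).trans
    (and_iff_right hf)

lemma eventually_mem_baseSet (hf : MDifferentiableAt 𝓘(ℝ, E) 𝓘(ℝ, E') f p) :
    ∀ᶠ q in 𝓝 p, f q ∈
      (trivializationAt E' (TangentSpace 𝓘(ℝ, E') : N → Type _) (f p)).baseSet :=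
  hf.continuousAt.preimage_mem_nhds
    ((Trivialization.open_baseSet _).mem_nhds (FiberBundle.mem_baseSet_trivializationAt' _))

lemma trivializationAt_add_eventuallyEq (hf : MDifferentiableAt 𝓘(ℝ, E) 𝓘(ℝ, E') f p)
    (σ τ : Π q : M, TangentSpace 𝓘(ℝ, E') (f q)) :
    (fun q ↦ (trivializationAt E' (TangentSpace 𝓘(ℝ, E') : N → Type _) (f p)
        ⟨f q, σ q + τ q⟩).2) =ᶠ[𝓝 p]
      (fun q ↦ (trivializationAt E' (TangentSpace 𝓘(ℝ, E') : N → Type _) (f p) ⟨f q, σ q⟩).2) +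
      (fun q ↦ (trivializationAt E' (TangentSpace 𝓘(ℝ, E') : N → Type _) (f p) ⟨f q, τ q⟩).2) := by
  filter_upwards [eventually_mem_baseSet hf] with q hq
  exact (Trivialization.linear ℝ _ hq).map_add _ _

lemma trivializationAt_smul_eventuallyEq (hf : MDifferentiableAt 𝓘(ℝ, E) 𝓘(ℝ, E') f p)
    (g : M → ℝ) (σ : Π q : M, TangentSpace 𝓘(ℝ, E') (f q)) :
    (fun q ↦ (trivializationAt E' (TangentSpace 𝓘(ℝ, E') : N → Type _) (f p)
        ⟨f q, g q • σ q⟩).2) =ᶠ[𝓝 p]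
      g • (fun q ↦ (trivializationAt E' (TangentSpace 𝓘(ℝ, E') : N → Type _) (f p)
        ⟨f q, σ q⟩).2) := by
  filter_upwards [eventually_mem_baseSet hf] with q hq
  exact (Trivialization.linear ℝ _ hq).map_smul _ _

lemma MDiffAlongAt.add (hf : MDifferentiableAt 𝓘(ℝ, E) 𝓘(ℝ, E') f p)
    (hσ : MDiffAlongAt (E := E) f σ p) (hτ : MDiffAlongAt (E := E) f τ p) :
    MDiffAlongAt (E := E) f (fun q ↦ σ q + τ q) p := by
  rw [mdiffAlongAt_iff hf] at *
  exact (hσ.add hτ).congr_of_eventuallyEq (trivializationAt_add_eventuallyEq hf σ τ)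

lemma MDiffAlongAt.smul (hf : MDifferentiableAt 𝓘(ℝ, E) 𝓘(ℝ, E') f p) {g : M → ℝ}
    (hg : MDiffAt g p) (hσ : MDiffAlongAt (E := E) f σ p) :
    MDiffAlongAt (E := E) f (fun q ↦ g q • σ q) p := by
  rw [mdiffAlongAt_iff hf] at *
  exact (hg.smul hσ).congr_of_eventuallyEq (trivializationAt_smul_eventuallyEq hf g σ)

lemma MDiffAlongAt.comp (hf : MDifferentiableAt 𝓘(ℝ, E) 𝓘(ℝ, E') f p)
    {Y : Π x : N, TangentSpace 𝓘(ℝ, E') x} (hY : MDiffAt (T% Y) (f p)) :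
    MDiffAlongAt (E := E) f (fun q ↦ Y (f q)) p :=
  MDifferentiableAt.comp p hY hf

lemma MDiffAlongAt.sum (hf : MDifferentiableAt 𝓘(ℝ, E) 𝓘(ℝ, E') f p) {ι : Type*} (s : Finset ι)
    {σ : ι → Π q : M, TangentSpace 𝓘(ℝ, E') (f q)}
    (hσ : ∀ i, MDiffAlongAt (E := E) f (σ i) p) :
    MDiffAlongAt (E := E) f (fun q ↦ ∑ i ∈ s, σ i q) p := by
  classical
  induction s using Finset.induction_on with
  | empty =>
    simp only [Finset.sum_empty]
    exact MDiffAlongAt.comp hf (mdifferentiableAt_zeroSection (𝕜 := ℝ) (F := E')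
      (E := fun x : N ↦ TangentSpace 𝓘(ℝ, E') x))
  | insert a s ha ih =>
    simp only [Finset.sum_insert ha]
    exact (hσ a).add hf ih

/-- Sections along `f` are generated, near a point and over functions on `M`, by the restrictions
of smooth vector fields on `N`. -/
lemma MDiffAlongAt.induction [T2Space N] (hf : MDifferentiableAt 𝓘(ℝ, E) 𝓘(ℝ, E') f p)
    {P : (Π q : M, TangentSpace 𝓘(ℝ, E') (f q)) → Prop}
    (congr : ∀ σ τ, MDiffAlongAt (E := E) f σ p → (∀ᶠ q in 𝓝 p, τ q = σ q) → P σ → P τ)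
    (add : ∀ σ τ, MDiffAlongAt (E := E) f σ p → MDiffAlongAt (E := E) f τ p → P σ → P τ →
      P (fun q ↦ σ q + τ q))
    (smul : ∀ (g : M → ℝ) (σ), MDifferentiableAt 𝓘(ℝ, E) 𝓘(ℝ, ℝ) g p →
      MDiffAlongAt (E := E) f σ p → P σ → P (fun q ↦ g q • σ q))
    (comp : ∀ Y : Π x : N, TangentSpace 𝓘(ℝ, E') x, IsSmoothVectorField 𝓘(ℝ, E') Y →
      P (fun q ↦ Y (f q)))
    (hσ : MDiffAlongAt (E := E) f σ p) : P σ := by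
  classical
  let e := trivializationAt E' (TangentSpace 𝓘(ℝ, E') : N → Type _) (f p)
  have he : f p ∈ e.baseSet := FiberBundle.mem_baseSet_trivializationAt' _
  let b := Module.finBasis ℝ E'
  have hframe (a : Fin (Module.finrank ℝ E')) :
      ∃ Z : Π x : N, TangentSpace 𝓘(ℝ, E') x, IsSmoothVectorField 𝓘(ℝ, E') Z ∧
        ∀ᶠ x in 𝓝 (f p), Z x = e.symm x (b a) := by
    obtain ⟨s, hs, hsm⟩ := FiberBundle.exists_contMDiffOn_extend 𝓘(ℝ, E') E' (k := ∞)
      (e.symm (f p) (b a))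
    obtain ⟨Z, hZ, hZs, -⟩ := exists_isSmoothVectorField_eventuallyEq hs hsm
    refine ⟨Z, hZ, hZs.mono fun x hx ↦ hx.trans ?_⟩
    rw [FiberBundle.extend, e.apply_mk_symm he]
  choose Z hZ hZe using hframe
  let c (a : Fin (Module.finrank ℝ E')) (q : M) : ℝ := b.repr (e ⟨f q, σ q⟩).2 a
  have hc (a) : MDifferentiableAt 𝓘(ℝ, E) 𝓘(ℝ, ℝ) (c a) p := by
    have h1 := (mdiffAlongAt_iff hf).1 hσ
    have h2 : DifferentiableAt ℝ (fun w ↦ b.repr w a) (e ⟨f p, σ p⟩).2 :=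
      (LinearMap.toContinuousLinearMap (b.coord a)).differentiableAt
    exact MDifferentiableAt.comp p h2.mdifferentiableAt h1
  have hterm (a) : MDiffAlongAt (E := E) f (fun q ↦ Z a (f q)) p :=
    MDiffAlongAt.comp hf ((hZ a).mdiffAt _)
  have hsum (s : Finset (Fin (Module.finrank ℝ E'))) :
      P (fun q ↦ ∑ a ∈ s, c a q • Z a (f q)) := by
    induction s using Finset.induction_on with
    | empty =>
      simp only [Finset.sum_empty]
      exact comp 0 (contMDiff_zeroSection ℝ (fun x : N ↦ TangentSpace 𝓘(ℝ, E') x))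
    | insert a s ha ih =>
      simp only [Finset.sum_insert ha]
      exact add _ _ ((hterm a).smul hf (hc a))
        (MDiffAlongAt.sum hf s fun a ↦ (hterm a).smul hf (hc a)) (smul _ _ (hc a) (hterm a)
          (comp _ (hZ a))) ih
  refine congr _ _ (MDiffAlongAt.sum hf _ fun a ↦ (hterm a).smul hf (hc a)) ?_ (hsum Finset.univ)
  have hZf : ∀ᶠ q in 𝓝 p, ∀ a, Z a (f q) = e.symm (f q) (b a) :=
    Filter.eventually_all.2 fun a ↦ hf.continuousAt.eventually (hZe a)
  filter_upwards [hZf, eventually_mem_baseSet hf] with q hq hqe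
  have h1 : σ q = e.symmL ℝ (f q) (e ⟨f q, σ q⟩).2 :=
    ((e.symmL_apply (R := ℝ) hqe _).trans (e.symm_apply_apply_mk hqe (σ q))).symm
  conv_lhs => rw [h1, ← b.sum_repr (e ⟨f q, σ q⟩).2, map_sum]
  refine Finset.sum_congr rfl fun a _ ↦ ?_
  rw [map_smul, hq a, e.symmL_apply (R := ℝ) hqe]

section Connection
variable (cov : CovariantDerivative 𝓘(ℝ, E') E' (TangentSpace 𝓘(ℝ, E') : N → Type _))

lemma cov_extend_add {x : N} (u w : TangentSpace 𝓘(ℝ, E') x) :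
    cov (FiberBundle.extend E' (u + w)) x =
      cov (FiberBundle.extend E' u) x + cov (FiberBundle.extend E' w) x := by
  have hu := FiberBundle.mdifferentiableAt_extend 𝓘(ℝ, E') E' u
  have hw := FiberBundle.mdifferentiableAt_extend 𝓘(ℝ, E') E' w
  rw [← cov.isCovariantDerivativeOnUniv.add hu hw]
  refine cov.isCovariantDerivativeOnUniv.congr_of_eventuallyEq
    (FiberBundle.mdifferentiableAt_extend 𝓘(ℝ, E') E' _) (mdifferentiableAt_add_section hu hw)
    Filter.univ_mem ?_
  let e := trivializationAt E' (TangentSpace 𝓘(ℝ, E') : N → Type _) x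
  have he : x ∈ e.baseSet := FiberBundle.mem_baseSet_trivializationAt' _
  filter_upwards [e.open_baseSet.mem_nhds he] with q hq
  simp only [FiberBundle.extend, Pi.add_apply]
  rw [(e.linear ℝ he).map_add, ← e.symmL_apply (R := ℝ) hq, ← e.symmL_apply (R := ℝ) hq,
    ← e.symmL_apply (R := ℝ) hq, map_add]

lemma cov_extend_smul {x : N} (c : ℝ) (u : TangentSpace 𝓘(ℝ, E') x) :
    cov (FiberBundle.extend E' (c • u)) x = c • cov (FiberBundle.extend E' u) x := by
  have hu := FiberBundle.mdifferentiableAt_extend 𝓘(ℝ, E') E' u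
  rw [← cov.isCovariantDerivativeOnUniv.smul_const c hu]
  refine cov.isCovariantDerivativeOnUniv.congr_of_eventuallyEq
    (FiberBundle.mdifferentiableAt_extend 𝓘(ℝ, E') E' _)
    (mdifferentiableAt_const.smul_section hu) Filter.univ_mem ?_
  let e := trivializationAt E' (TangentSpace 𝓘(ℝ, E') : N → Type _) x
  have he : x ∈ e.baseSet := FiberBundle.mem_baseSet_trivializationAt' _
  filter_upwards [e.open_baseSet.mem_nhds he] with q hq
  simp only [FiberBundle.extend, Pi.smul_apply]
  rw [(e.linear ℝ he).map_smul, ← e.symmL_apply (R := ℝ) hq, ← e.symmL_apply (R := ℝ) hq, map_smul]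

lemma covAlong_congr (h : ∀ᶠ q in 𝓝 p, τ q = σ q) :
    covAlong 𝓘(ℝ, E) cov f τ p = covAlong 𝓘(ℝ, E) cov f σ p := by
  have h1 : (fun q ↦ (trivializationAt E' (TangentSpace 𝓘(ℝ, E') : N → Type _) (f p)
      ⟨f q, τ q⟩).2) =ᶠ[𝓝 p] fun q ↦ (trivializationAt E' (TangentSpace 𝓘(ℝ, E') : N → Type _) (f p)
      ⟨f q, σ q⟩).2 := h.mono fun q hq ↦ by simp only [hq]
  simp only [covAlong]
  rw [mvfderiv_congr h1, h.self_of_nhds]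

lemma covAlong_add (hf : MDifferentiableAt 𝓘(ℝ, E) 𝓘(ℝ, E') f p)
    (hσ : MDiffAlongAt (E := E) f σ p) (hτ : MDiffAlongAt (E := E) f τ p) :
    covAlong 𝓘(ℝ, E) cov f (fun q ↦ σ q + τ q) p =
      covAlong 𝓘(ℝ, E) cov f σ p + covAlong 𝓘(ℝ, E) cov f τ p := by
  rw [mdiffAlongAt_iff hf] at hσ hτ
  simp only [covAlong]
  rw [mvfderiv_congr (trivializationAt_add_eventuallyEq hf σ τ), mvfderiv_add hσ hτ,
    cov_extend_add]
  ext v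
  simp only [ContinuousLinearMap.comp_apply, _root_.add_apply, map_add]
  abel

lemma covAlong_smul (hf : MDifferentiableAt 𝓘(ℝ, E) 𝓘(ℝ, E') f p) {g : M → ℝ}
    (hg : MDiffAt g p) (hσ : MDiffAlongAt (E := E) f σ p) (v : TangentSpace 𝓘(ℝ, E) p) :
    covAlong 𝓘(ℝ, E) cov f (fun q ↦ g q • σ q) p v =
      g p • covAlong 𝓘(ℝ, E) cov f σ p v + mvfderiv 𝓘(ℝ, E) g p v • σ p := by
  rw [mdiffAlongAt_iff hf] at hσ
  simp only [covAlong]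
  rw [mvfderiv_congr (trivializationAt_smul_eventuallyEq hf g σ), mvfderiv_smul hg hσ,
    cov_extend_smul]
  let e := trivializationAt E' (TangentSpace 𝓘(ℝ, E') : N → Type _) (f p)
  have he : f p ∈ e.baseSet := FiberBundle.mem_baseSet_trivializationAt' _
  have h1 : e.symmL ℝ (f p) (e ⟨f p, σ p⟩).2 = σ p :=
    (e.symmL_apply (R := ℝ) he _).trans (e.symm_apply_apply_mk he (σ p))
  simp only [ContinuousLinearMap.comp_apply, _root_.add_apply, _root_.smul_apply,
    ContinuousLinearMap.smulRight_apply, map_add, map_smul]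
  rw [h1, smul_add]
  abel

end Connection

end SectionsAlong
end Slant

namespace Slant

section SectionsAlong
variable {E : Type*} [NormedAddCommGroup E] [NormedSpace ℝ E] [FiniteDimensional ℝ E]
  {M : Type*} [TopologicalSpace M] [ChartedSpace E M] [IsManifold 𝓘(ℝ, E) ∞ M]
  {E' : Type*} [NormedAddCommGroup E'] [NormedSpace ℝ E'] [FiniteDimensional ℝ E']
  {N : Type*} [TopologicalSpace N] [ChartedSpace E' N] [IsManifold 𝓘(ℝ, E') ∞ N]
  [RiemannianBundle (fun x : N ↦ TangentSpace 𝓘(ℝ, E') x)]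
  [IsContMDiffRiemannianBundle 𝓘(ℝ, E') ∞ E' (fun x : N ↦ TangentSpace 𝓘(ℝ, E') x)]
  {f : M → N} {p : M} {σ τ : Π q : M, TangentSpace 𝓘(ℝ, E') (f q)}

lemma exists_isSmoothVectorField_apply_eq [T2Space N] {x : N} (v : TangentSpace 𝓘(ℝ, E') x) :
    ∃ Z : Π y : N, TangentSpace 𝓘(ℝ, E') y, IsSmoothVectorField 𝓘(ℝ, E') Z ∧ Z x = v := by
  obtain ⟨s, hs, hsm⟩ := FiberBundle.exists_contMDiffOn_extend 𝓘(ℝ, E') E' (k := ∞) v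
  obtain ⟨Z, hZ, hZs, -⟩ := exists_isSmoothVectorField_eventuallyEq hs hsm
  exact ⟨Z, hZ, hZs.self_of_nhds.trans (FiberBundle.extend_apply_self ..)⟩

lemma MDiffAlongAt.inner (hσ : MDiffAlongAt (E := E) f σ p) (hτ : MDiffAlongAt (E := E) f τ p) :
    MDifferentiableAt 𝓘(ℝ, E) 𝓘(ℝ, ℝ) (fun q ↦ inner ℝ (σ q) (τ q)) p :=
  MDifferentiableAt.inner_bundle (F := E') (E := fun x : N ↦ TangentSpace 𝓘(ℝ, E') x) hσ hτ

/-- The pull-back of the Levi-Civita connection is compatible with the metric. -/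
lemma covAlong_metric [T2Space N] (hf : MDifferentiableAt 𝓘(ℝ, E) 𝓘(ℝ, E') f p)
    (hσ : MDiffAlongAt (E := E) f σ p) (hτ : MDiffAlongAt (E := E) f τ p)
    (v : TangentSpace 𝓘(ℝ, E) p) :
    mvfderiv 𝓘(ℝ, E) (fun q ↦ inner ℝ (σ q) (τ q)) p v =
      inner ℝ (covAlong 𝓘(ℝ, E) (leviCivita 𝓘(ℝ, E') N) f σ p v) (τ p) +
        inner ℝ (σ p) (covAlong 𝓘(ℝ, E) (leviCivita 𝓘(ℝ, E') N) f τ p v) := by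
  revert hτ
  refine MDiffAlongAt.induction (P := fun σ ↦ MDiffAlongAt (E := E) f τ p →
    mvfderiv 𝓘(ℝ, E) (fun q ↦ inner ℝ (σ q) (τ q)) p v =
      inner ℝ (covAlong 𝓘(ℝ, E) (leviCivita 𝓘(ℝ, E') N) f σ p v) (τ p) +
        inner ℝ (σ p) (covAlong 𝓘(ℝ, E) (leviCivita 𝓘(ℝ, E') N) f τ p v)) hf ?_ ?_ ?_ ?_ hσ
  · intro σ σ' hσ h ih hτ
    have h1 : (fun q ↦ inner ℝ (σ' q) (τ q)) =ᶠ[𝓝 p] fun q ↦ inner ℝ (σ q) (τ q) :=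
      h.mono fun q hq ↦ by simp only [hq]
    rw [covAlong_congr _ h, h.self_of_nhds, mvfderiv_congr h1, ih hτ]
  · intro σ σ' hσ hσ' ih ih' hτ
    rw [covAlong_add _ hf hσ hσ']
    simp only [inner_add_left, _root_.add_apply]
    rw [mvfderiv_fun_add (hσ.inner hτ) (hσ'.inner hτ), _root_.add_apply, ih hτ, ih' hτ]
    ring
  · intro g σ hg hσ ih hτ
    rw [covAlong_smul _ hf hg hσ]
    simp only [inner_add_left, real_inner_smul_left]
    rw [mvfderiv_fun_mul hg (hσ.inner hτ)]
    simp only [_root_.add_apply, _root_.smul_apply, smul_eq_mul]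
    rw [ih hτ]
    ring
  · intro Y hY hτ
    have hYf : MDiffAlongAt (E := E) f (fun q ↦ Y (f q)) p := .comp hf (hY.mdiffAt _)
    refine MDiffAlongAt.induction (P := fun τ ↦
      mvfderiv 𝓘(ℝ, E) (fun q ↦ inner ℝ (Y (f q)) (τ q)) p v =
        inner ℝ (covAlong 𝓘(ℝ, E) (leviCivita 𝓘(ℝ, E') N) f (fun q ↦ Y (f q)) p v) (τ p) +
          inner ℝ (Y (f p)) (covAlong 𝓘(ℝ, E) (leviCivita 𝓘(ℝ, E') N) f τ p v)) hf ?_ ?_ ?_ ?_ hτ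
    · intro τ τ' hτ h ih
      have h1 : (fun q ↦ inner ℝ (Y (f q)) (τ' q)) =ᶠ[𝓝 p] fun q ↦ inner ℝ (Y (f q)) (τ q) :=
        h.mono fun q hq ↦ by simp only [hq]
      rw [covAlong_congr _ h, h.self_of_nhds, mvfderiv_congr h1, ih]
    · intro τ τ' hτ hτ' ih ih'
      rw [covAlong_add _ hf hτ hτ']
      simp only [inner_add_right, _root_.add_apply]
      rw [mvfderiv_fun_add (hYf.inner hτ) (hYf.inner hτ'), _root_.add_apply, ih, ih']
      ring
    · intro g τ hg hτ ih
      rw [covAlong_smul _ hf hg hτ]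
      simp only [inner_add_right, real_inner_smul_right]
      rw [mvfderiv_fun_mul hg (hYf.inner hτ)]
      simp only [_root_.add_apply, _root_.smul_apply, smul_eq_mul]
      rw [ih]
      ring
    · intro Z hZ
      rw [covAlong_comp _ hf (hY.mdiffAt _), covAlong_comp _ hf (hZ.mdiffAt _)]
      have h1 := mvfderiv_comp p (mdiffAt_inner (hY.mdiffAt (f p)) (hZ.mdiffAt (f p))) hf
      obtain ⟨X, hX, hXv⟩ :=
        exists_isSmoothVectorField_apply_eq (mfderiv 𝓘(ℝ, E) 𝓘(ℝ, E') f p v)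
      have h2 := leviCivita_metric (hX.mdiffAt (f p)) (hY.mdiffAt (f p)) (hZ.mdiffAt (f p))
      rw [hXv] at h2
      refine Eq.trans ?_ h2
      exact congrArg (fun L : TangentSpace 𝓘(ℝ, E) p →L[ℝ] ℝ ↦ L v) h1

namespace AlmostHermitianStructure
variable (S : AlmostHermitianStructure 𝓘(ℝ, E') N)

lemma mdiffAlongAt (hf : MDifferentiableAt 𝓘(ℝ, E) 𝓘(ℝ, E') f p)
    (hσ : MDiffAlongAt (E := E) f σ p) :
    MDiffAlongAt (E := E) f (fun q ↦ S.φ (f q) (σ q)) p := by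
  have h1 := ((S.contMDiff (f p)).mdifferentiableAt (by simp)).comp p hf
  exact MDifferentiableAt.clm_bundle_apply (F₁ := E') (F₂ := E')
    (E₁ := fun x : N ↦ TangentSpace 𝓘(ℝ, E') x) (E₂ := fun x : N ↦ TangentSpace 𝓘(ℝ, E') x) h1 hσ

lemma contMDiff_along (hf : ContMDiff 𝓘(ℝ, E) 𝓘(ℝ, E') ∞ f)
    (hσ : ContMDiff 𝓘(ℝ, E) 𝓘(ℝ, E').tangent ∞
      (fun q ↦ (⟨f q, σ q⟩ : TangentBundle 𝓘(ℝ, E') N))) :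
    ContMDiff 𝓘(ℝ, E) 𝓘(ℝ, E').tangent ∞
      (fun q ↦ (⟨f q, S.φ (f q) (σ q)⟩ : TangentBundle 𝓘(ℝ, E') N)) :=
  ContMDiff.clm_bundle_apply (F₁ := E') (F₂ := E')
    (E₁ := fun x : N ↦ TangentSpace 𝓘(ℝ, E') x) (E₂ := fun x : N ↦ TangentSpace 𝓘(ℝ, E') x)
    (S.contMDiff.comp hf) hσ

/-- On a Kähler manifold, `φ` is parallel along any map. -/
lemma IsKahler.covAlong_φ {S : AlmostHermitianStructure 𝓘(ℝ, E') N} [T2Space N] (hS : S.IsKahler)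
    (hf : MDifferentiableAt 𝓘(ℝ, E) 𝓘(ℝ, E') f p)
    (hσ : MDiffAlongAt (E := E) f σ p) (v : TangentSpace 𝓘(ℝ, E) p) :
    covAlong 𝓘(ℝ, E) (leviCivita 𝓘(ℝ, E') N) f (fun q ↦ S.φ (f q) (σ q)) p v =
      S.φ (f p) (covAlong 𝓘(ℝ, E) (leviCivita 𝓘(ℝ, E') N) f σ p v) := by
  refine MDiffAlongAt.induction (P := fun σ ↦
    covAlong 𝓘(ℝ, E) (leviCivita 𝓘(ℝ, E') N) f (fun q ↦ S.φ (f q) (σ q)) p v =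
      S.φ (f p) (covAlong 𝓘(ℝ, E) (leviCivita 𝓘(ℝ, E') N) f σ p v)) hf ?_ ?_ ?_ ?_ hσ
  · intro σ τ hσ h ih
    rw [covAlong_congr _ h, ← ih, covAlong_congr _ (h.mono fun q hq ↦ by rw [hq])]
  · intro σ τ hσ hτ ih ih'
    simp only [map_add]
    rw [covAlong_add _ hf hσ hτ, covAlong_add _ hf (S.mdiffAlongAt hf hσ) (S.mdiffAlongAt hf hτ)]
    simp only [_root_.add_apply, map_add]
    rw [ih, ih']
  · intro g σ hg hσ ih
    simp only [map_smul]
    rw [covAlong_smul _ hf hg hσ, covAlong_smul _ hf hg (S.mdiffAlongAt hf hσ), ih]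
    simp only [map_add, map_smul]
  · intro Y hY
    have hφY : IsSmoothVectorField 𝓘(ℝ, E') (fun x ↦ S.φ x (Y x)) :=
      S.contMDiff_along contMDiff_id hY
    rw [covAlong_comp _ hf (hY.mdiffAt _),
      covAlong_comp (Y := fun x ↦ S.φ x (Y x)) _ hf (hφY.mdiffAt _)]
    obtain ⟨X, hX, hXv⟩ := exists_isSmoothVectorField_apply_eq (mfderiv 𝓘(ℝ, E) 𝓘(ℝ, E') f p v)
    have h := hS X Y hX hY (f p)
    rwa [hXv] at h

end AlmostHermitianStructure

lemma trivializationAt_snd_eq_mvfderiv {x y : N} (hy : y ∈ (chartAt E' x).source)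
    (w : TangentSpace 𝓘(ℝ, E') y) :
    (trivializationAt E' (TangentSpace 𝓘(ℝ, E') : N → Type _) x ⟨y, w⟩).2 =
      mvfderiv 𝓘(ℝ, E') (extChartAt 𝓘(ℝ, E') x) y w := by
  have h := TangentBundle.continuousLinearMapAt_trivializationAt (I := 𝓘(ℝ, E')) hy
  have h2 : (trivializationAt E' (TangentSpace 𝓘(ℝ, E') : N → Type _) x ⟨y, w⟩).2 =
      (trivializationAt E' (TangentSpace 𝓘(ℝ, E') : N → Type _) x).continuousLinearMapAt ℝ y w := by
    rw [Trivialization.continuousLinearMapAt_apply,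
      Trivialization.coe_linearMapAt_of_mem _ (by simpa using hy)]
  rw [h2]
  exact congrArg (fun L : E' →L[ℝ] E' ↦ L w) h

/-- Extensions of tangent vectors by constant coordinates commute. -/
lemma mlieBracket_extend {x : N} (u w : TangentSpace 𝓘(ℝ, E') x) :
    mlieBracket 𝓘(ℝ, E') (FiberBundle.extend E' u) (FiberBundle.extend E' w) x = 0 := by
  let e := trivializationAt E' (TangentSpace 𝓘(ℝ, E') : N → Type _) x
  have hconst (u : TangentSpace 𝓘(ℝ, E') x) :
      (fun y ↦ mvfderiv 𝓘(ℝ, E') (extChartAt 𝓘(ℝ, E') x) y (FiberBundle.extend E' u y)) =ᶠ[𝓝 x]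
        fun _ ↦ (e ⟨x, u⟩).2 := by
    filter_upwards [chart_source_mem_nhds E' x] with y hy
    rw [← trivializationAt_snd_eq_mvfderiv hy, FiberBundle.extend,
      Trivialization.apply_mk_symm _ (by simpa using hy)]
  have h := mvfderiv_mlieBracket (contMDiffAt_extChartAt (I := 𝓘(ℝ, E')) (x := x) (n := ∞))
    (FiberBundle.mdifferentiableAt_extend 𝓘(ℝ, E') E' u)
    (FiberBundle.mdifferentiableAt_extend 𝓘(ℝ, E') E' w)
  rw [mvfderiv_congr (hconst u), mvfderiv_congr (hconst w), mvfderiv_const, mvfderiv_const] at h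
  simp only [_root_.zero_apply, sub_zero] at h
  have h3 : mfderiv 𝓘(ℝ, E') 𝓘(ℝ, E') (extChartAt 𝓘(ℝ, E') x) x
      (mlieBracket 𝓘(ℝ, E') (FiberBundle.extend E' u) (FiberBundle.extend E' w) x) = 0 := h
  rw [mfderiv_extChartAt_self] at h3
  exact h3

lemma mdiffAlongAt_mfderiv (hf : ContMDiff 𝓘(ℝ, E) 𝓘(ℝ, E') ∞ f)
    {Y : Π q : M, TangentSpace 𝓘(ℝ, E) q} (hY : MDiffAt (T% Y) p) :
    MDiffAlongAt (E := E) f (fun q ↦ mfderiv 𝓘(ℝ, E) 𝓘(ℝ, E') f q (Y q)) p :=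
  ((hf.contMDiff_tangentMap (m := 1) (by exact ENat.LEInfty.out (m := 2))).mdifferentiable
    one_ne_zero _).comp p hY

/-- The pull-back of the Levi-Civita connection is torsion-free. -/
lemma covAlong_torsion (hf : ContMDiff 𝓘(ℝ, E) 𝓘(ℝ, E') ∞ f)
    {X Y : Π q : M, TangentSpace 𝓘(ℝ, E) q} (hX : MDiffAt (T% X) p) (hY : MDiffAt (T% Y) p) :
    covAlong 𝓘(ℝ, E) (leviCivita 𝓘(ℝ, E') N) f
        (fun q ↦ mfderiv 𝓘(ℝ, E) 𝓘(ℝ, E') f q (Y q)) p (X p) -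
      covAlong 𝓘(ℝ, E) (leviCivita 𝓘(ℝ, E') N) f
        (fun q ↦ mfderiv 𝓘(ℝ, E) 𝓘(ℝ, E') f q (X q)) p (Y p) =
    mfderiv 𝓘(ℝ, E) 𝓘(ℝ, E') f p (mlieBracket 𝓘(ℝ, E) X Y p) := by
  have := FiniteDimensional.complete ℝ E'
  let e := trivializationAt E' (TangentSpace 𝓘(ℝ, E') : N → Type _) (f p)
  have he : f p ∈ e.baseSet := FiberBundle.mem_baseSet_trivializationAt' _
  let F : M → E' := extChartAt 𝓘(ℝ, E') (f p) ∘ f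
  have hF : ContMDiffAt 𝓘(ℝ, E) 𝓘(ℝ, E') ∞ F p :=
    ContMDiffAt.comp p contMDiffAt_extChartAt (hf p)
  have hcoord (q : M) (hq : f q ∈ (chartAt E' (f p)).source) (w : TangentSpace 𝓘(ℝ, E) q) :
      (e ⟨f q, mfderiv 𝓘(ℝ, E) 𝓘(ℝ, E') f q w⟩).2 = mvfderiv 𝓘(ℝ, E) F q w := by
    rw [trivializationAt_snd_eq_mvfderiv hq]
    have h := mfderiv_comp q (mdifferentiableAt_extChartAt (I := 𝓘(ℝ, E')) hq)
      ((hf q).mdifferentiableAt (by simp))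
    exact (congrArg (fun L : TangentSpace 𝓘(ℝ, E) q →L[ℝ] E' ↦ L w) h).symm
  have hnear (Z : Π q : M, TangentSpace 𝓘(ℝ, E) q) :
      (fun q ↦ (e ⟨f q, mfderiv 𝓘(ℝ, E) 𝓘(ℝ, E') f q (Z q)⟩).2) =ᶠ[𝓝 p]
        fun q ↦ mvfderiv 𝓘(ℝ, E) F q (Z q) := by
    filter_upwards [hf.continuous.continuousAt.preimage_mem_nhds
      (chart_source_mem_nhds E' (f p))] with q hq
    exact hcoord q hq _
  have hcov (Z : Π q : M, TangentSpace 𝓘(ℝ, E) q) (v : TangentSpace 𝓘(ℝ, E) p) :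
      covAlong 𝓘(ℝ, E) (leviCivita 𝓘(ℝ, E') N) f
        (fun q ↦ mfderiv 𝓘(ℝ, E) 𝓘(ℝ, E') f q (Z q)) p v =
      e.symmL ℝ (f p) (mvfderiv 𝓘(ℝ, E) (fun q ↦ mvfderiv 𝓘(ℝ, E) F q (Z q)) p v) +
        leviCivita 𝓘(ℝ, E') N (FiberBundle.extend E' (mfderiv 𝓘(ℝ, E) 𝓘(ℝ, E') f p (Z p))) (f p)
          (mfderiv 𝓘(ℝ, E) 𝓘(ℝ, E') f p v) := by
    rw [← mvfderiv_congr (hnear Z)]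
    rfl
  have htor := (CovariantDerivative.torsion_eq_zero_iff _).1 (leviCivita_torsion (I := 𝓘(ℝ, E'))
    (M := N)) (FiberBundle.mdifferentiableAt_extend 𝓘(ℝ, E') E'
      (mfderiv 𝓘(ℝ, E) 𝓘(ℝ, E') f p (X p))) (FiberBundle.mdifferentiableAt_extend 𝓘(ℝ, E') E'
      (mfderiv 𝓘(ℝ, E) 𝓘(ℝ, E') f p (Y p)))
  rw [mlieBracket_extend, FiberBundle.extend_apply_self, FiberBundle.extend_apply_self] at htor
  have hbr : mfderiv 𝓘(ℝ, E) 𝓘(ℝ, E') f p (mlieBracket 𝓘(ℝ, E) X Y p) =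
      e.symmL ℝ (f p) (mvfderiv 𝓘(ℝ, E) F p (mlieBracket 𝓘(ℝ, E) X Y p)) := by
    rw [← hcoord p (mem_chart_source _ _)]
    exact ((e.symmL_apply (R := ℝ) he _).trans (e.symm_apply_apply_mk he _)).symm
  rw [hcov, hcov, hbr, mvfderiv_mlieBracket hF hX hY, map_sub, add_sub_add_comm, htor, add_zero]

end SectionsAlong

end Slant

namespace Slant
namespace RiemannianSubmanifold

section Submanifold
variable {E : Type*} [NormedAddCommGroup E] [NormedSpace ℝ E] [FiniteDimensional ℝ E]
  {M : Type*} [TopologicalSpace M] [ChartedSpace E M] [IsManifold 𝓘(ℝ, E) ∞ M]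
  [RiemannianBundle (fun x : M ↦ TangentSpace 𝓘(ℝ, E) x)]
  [IsContMDiffRiemannianBundle 𝓘(ℝ, E) ∞ E (fun x : M ↦ TangentSpace 𝓘(ℝ, E) x)]
  {E' : Type*} [NormedAddCommGroup E'] [NormedSpace ℝ E'] [FiniteDimensional ℝ E']
  {N : Type*} [TopologicalSpace N] [ChartedSpace E' N] [IsManifold 𝓘(ℝ, E') ∞ N]
  [RiemannianBundle (fun x : N ↦ TangentSpace 𝓘(ℝ, E') x)]
  [IsContMDiffRiemannianBundle 𝓘(ℝ, E') ∞ E' (fun x : N ↦ TangentSpace 𝓘(ℝ, E') x)]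
  (f : RiemannianSubmanifold 𝓘(ℝ, E) M 𝓘(ℝ, E') N)

lemma contMDiff_toFun : ContMDiff 𝓘(ℝ, E) 𝓘(ℝ, E') ∞ f.toFun := f.isImmersion.contMDiff

lemma mdifferentiableAt_toFun (p : M) :
    MDifferentiableAt 𝓘(ℝ, E) 𝓘(ℝ, E') f.toFun p :=
  (f.contMDiff_toFun p).mdifferentiableAt (by simp)

lemma mem_normalSpace_iff {p : M} {w : TangentSpace 𝓘(ℝ, E') (f.toFun p)} :
    w ∈ f.normalSpace p ↔ ∀ u, inner ℝ w (f.d p u) = 0 := by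
  rw [normalSpace, Submodule.mem_orthogonal']
  constructor
  · exact fun h u ↦ h _ ⟨u, rfl⟩
  · rintro h _ ⟨u, rfl⟩
    exact h u

lemma inner_tangentialPart {p : M} (w : TangentSpace 𝓘(ℝ, E') (f.toFun p))
    (u : TangentSpace 𝓘(ℝ, E) p) : inner ℝ (f.tangentialPart p w) u = inner ℝ w (f.d p u) := by
  conv_rhs => rw [← f.tangentialPart_add_normalPart p w]
  rw [inner_add_left, f.mem_normalSpace_iff.1 (f.normalPart p w).2, add_zero,
    LinearIsometry.inner_map_map]

lemma tangentialPart_d {p : M} (u : TangentSpace 𝓘(ℝ, E) p) :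
    f.tangentialPart p (f.d p u) = u :=
  ext_inner_right ℝ fun v ↦ by rw [inner_tangentialPart, LinearIsometry.inner_map_map]

lemma tangentialPart_of_mem_normalSpace {p : M} {w : TangentSpace 𝓘(ℝ, E') (f.toFun p)}
    (hw : w ∈ f.normalSpace p) : f.tangentialPart p w = 0 :=
  ext_inner_right ℝ fun v ↦ by
    rw [inner_tangentialPart, f.mem_normalSpace_iff.1 hw, inner_zero_left]

lemma coe_normalPart_of_mem_normalSpace {p : M} {w : TangentSpace 𝓘(ℝ, E') (f.toFun p)}
    (hw : w ∈ f.normalSpace p) : (f.normalPart p w : TangentSpace 𝓘(ℝ, E') (f.toFun p)) = w := by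
  have h := f.tangentialPart_add_normalPart p w
  rwa [f.tangentialPart_of_mem_normalSpace hw, map_zero, zero_add] at h

lemma mdiffAlongAt_d {p : M} {Y : Π q : M, TangentSpace 𝓘(ℝ, E) q} (hY : MDiffAt (T% Y) p) :
    MDiffAlongAt (E := E) f.toFun (fun q ↦ f.d q (Y q)) p :=
  mdiffAlongAt_mfderiv f.contMDiff_toFun hY

/-- The Gauss formula. -/
lemma tangentialPart_covAlong [T2Space N] {p : M} {X Y : Π q : M, TangentSpace 𝓘(ℝ, E) q}
    (hX : MDiffAt (T% X) p) (hY : MDiffAt (T% Y) p) :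
    f.tangentialPart p (covAlong 𝓘(ℝ, E) (leviCivita 𝓘(ℝ, E') N) f.toFun
      (fun q ↦ f.d q (Y q)) p (X p)) = leviCivita 𝓘(ℝ, E) M Y p (X p) := by
  refine ext_inner_right ℝ fun z ↦ ?_
  obtain ⟨Z, hZ, rfl⟩ : ∃ Z : Π q : M, TangentSpace 𝓘(ℝ, E) q, MDiffAt (T% Z) p ∧ Z p = z :=
    ⟨_, FiberBundle.mdifferentiableAt_extend 𝓘(ℝ, E) E z, FiberBundle.extend_apply_self ..⟩
  let A (X Y Z : Π q : M, TangentSpace 𝓘(ℝ, E) q) : ℝ :=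
    inner ℝ (covAlong 𝓘(ℝ, E) (leviCivita 𝓘(ℝ, E') N) f.toFun
      (fun q ↦ f.d q (Y q)) p (X p)) (f.d p (Z p))
  have hmetric {X Y Z : Π q : M, TangentSpace 𝓘(ℝ, E) q} (hY : MDiffAt (T% Y) p)
      (hZ : MDiffAt (T% Z) p) :
      mvfderiv 𝓘(ℝ, E) (fun q ↦ inner ℝ (Y q) (Z q)) p (X p) = A X Y Z + A X Z Y := by
    have h := covAlong_metric (f.mdifferentiableAt_toFun p) (f.mdiffAlongAt_d hY)
      (f.mdiffAlongAt_d hZ) (X p)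
    simp only [LinearIsometry.inner_map_map] at h
    rw [h, real_inner_comm _ (f.d p (Y p))]
  have htor {X Y Z : Π q : M, TangentSpace 𝓘(ℝ, E) q} (hX : MDiffAt (T% X) p)
      (hY : MDiffAt (T% Y) p) :
      inner ℝ (mlieBracket 𝓘(ℝ, E) X Y p) (Z p) = A X Y Z - A Y X Z := by
    have h := covAlong_torsion f.contMDiff_toFun hX hY
    rw [← LinearIsometry.inner_map_map (f.d p)]
    exact (congrArg (fun w ↦ inner ℝ w (f.d p (Z p))) h).symm.trans (inner_sub_left ..)
  rw [inner_tangentialPart]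
  refine Eq.trans ?_ (inner_leviCivitaFun hX hY hZ).symm
  rw [koszul, hmetric hY hZ, hmetric hZ hX, hmetric hX hY, htor hX hY, htor hY hZ, htor hZ hX]
  simp only [A]
  ring

/-- The decomposition of the derivative along the submanifold given by the Gauss formula. -/
lemma covAlong_d [T2Space N] {p : M} {X Y : Π q : M, TangentSpace 𝓘(ℝ, E) q}
    (hX : MDiffAt (T% X) p) (hY : MDiffAt (T% Y) p) :
    covAlong 𝓘(ℝ, E) (leviCivita 𝓘(ℝ, E') N) f.toFun (fun q ↦ f.d q (Y q)) p (X p) =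
      f.d p (leviCivita 𝓘(ℝ, E) M Y p (X p)) + f.h X Y p := by
  rw [← f.tangentialPart_covAlong hX hY]
  exact (f.tangentialPart_add_normalPart p _).symm

/-- An immersion has smooth local left inverses. -/
lemma exists_local_left_inverse (p : M) : ∃ (g : N → M) (U : Set N), IsOpen U ∧ f.toFun p ∈ U ∧
    ContMDiffOn 𝓘(ℝ, E') 𝓘(ℝ, E) ∞ g U ∧ ∀ᶠ q in 𝓝 p, g (f.toFun q) = q := by
  have h := f.isImmersion.isImmersionAt p
  let pr : E' → E := fun y ↦ (h.equiv.symm y).1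
  have hpr : ContDiff ℝ ∞ pr := contDiff_fst.comp h.equiv.symm.contDiff
  have hval (z : E) (hz : z ∈ h.domChart.target) :
      h.codChart (f.toFun (h.domChart.symm z)) = h.equiv (z, 0) := by
    have := h.writtenInCharts
      (show z ∈ (h.domChart.extend 𝓘(ℝ, E)).target by simpa using hz)
    simpa using this
  have hleft (q : M) (hq : q ∈ h.domChart.source) :
      pr (h.codChart (f.toFun q)) = h.domChart q := by
    have := hval _ (h.domChart.map_source hq)
    rw [h.domChart.left_inv hq] at this
    simp [pr, this]
  refine ⟨h.domChart.symm ∘ pr ∘ h.codChart, h.codChart.source ∩ h.codChart ⁻¹'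
    (pr ⁻¹' h.domChart.target), ?_, ⟨h.mem_codChart_source, ?_⟩, ?_, ?_⟩
  · exact h.codChart.isOpen_inter_preimage (h.domChart.open_target.preimage hpr.continuous)
  · rw [Set.mem_preimage, Set.mem_preimage, hleft p h.mem_domChart_source]
    exact h.domChart.map_source h.mem_domChart_source
  · refine (contMDiffOn_symm_of_mem_maximalAtlas h.domChart_mem_maximalAtlas).comp
      (t := h.domChart.target) ?_ fun q hq ↦ hq.2
    exact hpr.contMDiff.comp_contMDiffOn ((contMDiffOn_of_mem_maximalAtlas
      h.codChart_mem_maximalAtlas).mono Set.inter_subset_left)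
  · filter_upwards [h.domChart.open_source.mem_nhds h.mem_domChart_source] with q hq
    simp only [Function.comp_apply, hleft q hq]
    exact h.domChart.left_inv hq

/-- A vector field on the submanifold is smooth if it is smooth as a section along the
immersion. -/
lemma isSmoothVectorField_of_d {W : Π q : M, TangentSpace 𝓘(ℝ, E) q}
    (hW : ContMDiff 𝓘(ℝ, E) 𝓘(ℝ, E').tangent ∞
      (fun q ↦ (⟨f.toFun q, f.d q (W q)⟩ : TangentBundle 𝓘(ℝ, E') N))) :
    IsSmoothVectorField 𝓘(ℝ, E) W := by
  intro p
  obtain ⟨g, U, hU, hpU, hg, hgf⟩ := f.exists_local_left_inverse p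
  have h1 := hg.contMDiffOn_tangentMapWithin (m := ∞) (by simp) hU.uniqueMDiffOn
  have hUp : f.toFun ⁻¹' U ∈ 𝓝 p :=
    f.contMDiff_toFun.continuous.continuousAt.preimage_mem_nhds (hU.mem_nhds hpU)
  have h2 := ContMDiffAt.comp p (h1.contMDiffAt ?_) (hW p)
  swap
  · exact (hU.preimage (FiberBundle.continuous_proj E' _)).mem_nhds hpU
  refine h2.congr_of_eventuallyEq ?_
  filter_upwards [hgf.eventually_nhds, hUp] with q hq hqU
  have hq' : g (f.toFun q) = q := hq.self_of_nhds
  have h3 : MDifferentiableAt 𝓘(ℝ, E') 𝓘(ℝ, E) g (f.toFun q) :=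
    (hg.contMDiffAt (hU.mem_nhds hqU)).mdifferentiableAt (by simp)
  have h4 := mfderiv_comp q h3 (f.mdifferentiableAt_toFun q)
  have h5 : mfderiv 𝓘(ℝ, E) 𝓘(ℝ, E) (g ∘ f.toFun) q = mfderiv 𝓘(ℝ, E) 𝓘(ℝ, E) id q :=
    Filter.EventuallyEq.mfderiv_eq hq
  rw [Function.comp_apply, tangentMapWithin]
  simp only
  rw [mfderivWithin_of_mem_nhds (hU.mem_nhds hqU)]
  change _ = (⟨g (f.toFun q), (mfderiv 𝓘(ℝ, E') 𝓘(ℝ, E) g (f.toFun q) ∘L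
    mfderiv 𝓘(ℝ, E) 𝓘(ℝ, E') f.toFun q) (W q)⟩ : TangentBundle 𝓘(ℝ, E) M)
  rw [← h4, h5, mfderiv_id, hq']
  rfl

end Submanifold
end RiemannianSubmanifold
end Slant

namespace Slant

section PointwiseSlant
variable {E : Type*} [NormedAddCommGroup E] [NormedSpace ℝ E] [FiniteDimensional ℝ E]
  {M : Type*} [TopologicalSpace M] [ChartedSpace E M] [IsManifold 𝓘(ℝ, E) ∞ M]
  [RiemannianBundle (fun x : M ↦ TangentSpace 𝓘(ℝ, E) x)]
  [IsContMDiffRiemannianBundle 𝓘(ℝ, E) ∞ E (fun x : M ↦ TangentSpace 𝓘(ℝ, E) x)]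
  {E' : Type*} [NormedAddCommGroup E'] [NormedSpace ℝ E'] [FiniteDimensional ℝ E']
  {N : Type*} [TopologicalSpace N] [ChartedSpace E' N] [IsManifold 𝓘(ℝ, E') ∞ N]
  [RiemannianBundle (fun x : N ↦ TangentSpace 𝓘(ℝ, E') x)]
  [IsContMDiffRiemannianBundle 𝓘(ℝ, E') ∞ E' (fun x : N ↦ TangentSpace 𝓘(ℝ, E') x)]

namespace AlmostHermitianStructure
variable (S : AlmostHermitianStructure 𝓘(ℝ, E') N)

lemma inner_φ_left {x : N} (v w : TangentSpace 𝓘(ℝ, E') x) :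
    inner ℝ (S.φ x v) w = -inner ℝ v (S.φ x w) := by
  rw [← S.inner_map x (S.φ x v) w, S.sq, inner_neg_left]

lemma norm_φ {x : N} (v : TangentSpace 𝓘(ℝ, E') x) : ‖S.φ x v‖ = ‖v‖ := by
  rw [@norm_eq_sqrt_real_inner (TangentSpace 𝓘(ℝ, E') x), S.inner_map,
    ← @norm_eq_sqrt_real_inner (TangentSpace 𝓘(ℝ, E') x)]

end AlmostHermitianStructure

namespace RiemannianSubmanifold
variable {f : RiemannianSubmanifold 𝓘(ℝ, E) M 𝓘(ℝ, E') N}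
  {S : AlmostHermitianStructure 𝓘(ℝ, E') N} {p : M}

lemma T_apply (u : TangentSpace 𝓘(ℝ, E) p) :
    f.T S p u = f.tangentialPart p (S.φ (f.toFun p) (f.d p u)) := rfl

lemma inner_T_left (u v : TangentSpace 𝓘(ℝ, E) p) :
    inner ℝ (f.T S p u) v = -inner ℝ u (f.T S p v) := by
  rw [T_apply, inner_tangentialPart, S.inner_φ_left, ← real_inner_comm u, T_apply,
    inner_tangentialPart, real_inner_comm (f.d p u)]

namespace IsPointwiseSlant
variable {k : ℕ} {D : Fin (k + 1) → TangentDistribution 𝓘(ℝ, E) M} {θ : Fin (k + 1) → M → ℝ}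
  (hD : f.IsPointwiseSlant S k D θ)
include hD

lemma exists_sum (u : TangentSpace 𝓘(ℝ, E) p) :
    ∃ w : Fin (k + 1) → TangentSpace 𝓘(ℝ, E) p, (∀ i, w i ∈ D i p) ∧ ∑ i, w i = u := by
  have h : u ∈ ⨆ i, D i p := by
    rw [(hD.direct_sum p).submodule_iSup_eq_top]
    trivial
  rw [Submodule.mem_iSup_iff_exists_finsupp] at h
  obtain ⟨w, hw, rfl⟩ := h
  exact ⟨w, hw, (Finsupp.sum_fintype w (fun _ x ↦ x) fun _ ↦ rfl).symm⟩

lemma inner_sum {w : Fin (k + 1) → TangentSpace 𝓘(ℝ, E) p} (hw : ∀ i, w i ∈ D i p)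
    {i : Fin (k + 1)} {v : TangentSpace 𝓘(ℝ, E) p} (hv : v ∈ D i p) :
    inner ℝ v (∑ j, w j) = inner ℝ v (w i) := by
  rw [_root_.inner_sum, Finset.sum_eq_single i]
  · exact fun j _ hj ↦ hD.orthogonal i j hj.symm p _ hv _ (hw j)
  · simp

lemma eq_zero_of_inner_sum_eq_zero {w : Fin (k + 1) → TangentSpace 𝓘(ℝ, E) p}
    (hw : ∀ i, w i ∈ D i p) {i : Fin (k + 1)} (h : ∀ v ∈ D i p, inner ℝ v (∑ j, w j) = 0) :
    w i = 0 := by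
  have := h _ (hw i)
  rwa [hD.inner_sum hw (hw i), inner_self_eq_zero] at this

lemma mem_iSup_succ_iff {u : TangentSpace 𝓘(ℝ, E) p} :
    u ∈ ⨆ i : Fin k, D i.succ p ↔ ∀ v ∈ D 0 p, inner ℝ v u = 0 := by
  constructor
  · intro hu v hv
    induction hu using Submodule.iSup_induction' with
    | mem i x hx => exact hD.orthogonal 0 i.succ (Fin.succ_ne_zero i).symm p v hv x hx
    | zero => exact inner_zero_right _
    | add x y _ _ hx hy => rw [inner_add_right, hx, hy, add_zero]
  · intro h
    obtain ⟨w, hw, rfl⟩ := hD.exists_sum u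
    rw [Fin.sum_univ_succ, hD.eq_zero_of_inner_sum_eq_zero hw h, zero_add]
    exact Submodule.sum_mem _ fun i _ ↦ Submodule.mem_iSup_of_mem i (hw _)

lemma φ_d_of_mem {u : TangentSpace 𝓘(ℝ, E) p} (hu : u ∈ D 0 p) :
    S.φ (f.toFun p) (f.d p u) = f.d p (f.T S p u) := by
  obtain ⟨v, -, hv⟩ := hD.invariant p u hu
  rw [T_apply, ← hv]
  exact congrArg (f.d p) (f.tangentialPart_d v).symm

lemma T_mem_of_mem {i : Fin (k + 1)} {u : TangentSpace 𝓘(ℝ, E) p} (hu : u ∈ D i p) :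
    f.T S p u ∈ D i p := by
  obtain rfl | hi := eq_or_ne i 0
  · obtain ⟨v, hv, hv'⟩ := hD.invariant p u hu
    rw [T_apply, ← hv']
    exact (f.tangentialPart_d v).symm ▸ hv
  · exact hD.T_mem i hi p u hu

lemma T_T_of_mem {u : TangentSpace 𝓘(ℝ, E) p} (hu : u ∈ D 0 p) :
    f.T S p (f.T S p u) = -u := by
  apply (f.d p).injective
  rw [← hD.φ_d_of_mem (hD.T_mem_of_mem hu), ← hD.φ_d_of_mem hu, S.sq, map_neg]

lemma norm_T {i : Fin (k + 1)} (hi : i ≠ 0) {u : TangentSpace 𝓘(ℝ, E) p} (hu : u ∈ D i p) :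
    ‖f.T S p u‖ = Real.cos (θ i p) * ‖u‖ := by
  obtain rfl | hu0 := eq_or_ne u 0
  · simp
  have hproj : f.d p (f.T S p u) = ((D i p).map (f.d p).toLinearMap).starProjection
      (S.φ (f.toFun p) (f.d p u)) := by
    have hmem : f.d p (f.T S p u) ∈ (D i p).map (f.d p).toLinearMap :=
      ⟨_, hD.T_mem_of_mem hu, rfl⟩
    refine (Submodule.eq_starProjection_of_mem_orthogonal hmem ?_).symm
    rw [Submodule.mem_orthogonal']
    rintro _ ⟨v, -, rfl⟩
    change inner ℝ _ (f.d p v) = 0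
    rw [inner_sub_left, LinearIsometry.inner_map_map, ← inner_tangentialPart, ← T_apply, sub_self]
  have h := hD.slant i hi p u hu hu0
  rw [angleTo, ← hproj] at h
  have h2 := InnerProductGeometry.cos_angle (S.φ (f.toFun p) (f.d p u)) (f.d p (f.T S p u))
  rw [h, ← inner_tangentialPart, ← T_apply, S.norm_φ, LinearIsometry.norm_map,
    LinearIsometry.norm_map, real_inner_self_eq_norm_mul_norm] at h2
  have hun : ‖u‖ ≠ 0 := norm_ne_zero_iff.2 hu0
  rw [h2]
  by_cases hT : ‖f.T S p u‖ = 0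
  · simp [hT]
  · field_simp

lemma mem_zero_iff {u : TangentSpace 𝓘(ℝ, E) p} :
    u ∈ D 0 p ↔ f.T S p (f.T S p u) = -u := by
  refine ⟨hD.T_T_of_mem, fun hu ↦ ?_⟩
  obtain ⟨w, hw, rfl⟩ := hD.exists_sum u
  have hz (i : Fin (k + 1)) : f.T S p (f.T S p (w i)) + w i = 0 := by
    refine hD.eq_zero_of_inner_sum_eq_zero (w := fun i ↦ f.T S p (f.T S p (w i)) + w i)
      (fun i ↦ add_mem (hD.T_mem_of_mem (hD.T_mem_of_mem (hw i))) (hw i)) fun v _ ↦ ?_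
    rw [Finset.sum_add_distrib, ← map_sum, ← map_sum, hu, neg_add_cancel, inner_zero_right]
  rw [Finset.sum_eq_single 0]
  · exact hw 0
  · intro i _ hi
    by_contra h0
    have h1 : ‖f.T S p (w i)‖ = ‖w i‖ := by
      rw [@norm_eq_sqrt_real_inner (TangentSpace 𝓘(ℝ, E) p), inner_T_left,
        eq_neg_of_add_eq_zero_left (hz i), inner_neg_right, neg_neg,
        ← @norm_eq_sqrt_real_inner (TangentSpace 𝓘(ℝ, E) p)]
    rw [hD.norm_T hi (hw i)] at h1
    have h2 : Real.cos (θ i p) = 1 := by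
      have : ‖w i‖ ≠ 0 := norm_ne_zero_iff.2 h0
      field_simp at h1
      exact h1
    have h3 := hD.theta_mem i hi p
    have h4 := Real.cos_lt_cos_of_nonneg_of_le_pi le_rfl
      (h3.2.trans (by linarith [Real.pi_pos])) h3.1
    rw [Real.cos_zero, h2] at h4
    exact lt_irrefl _ h4
  · simp

lemma eq_zero_of_T_eq_zero {i : Fin (k + 1)} (hθ : θ i p ≠ Real.pi / 2)
    {u : TangentSpace 𝓘(ℝ, E) p} (hu : u ∈ D i p) (h : f.T S p u = 0) : u = 0 := by
  obtain rfl | hi := eq_or_ne i 0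
  · have h1 := hD.T_T_of_mem hu
    rwa [h, map_zero, eq_comm, neg_eq_zero] at h1
  · have h1 := hD.norm_T hi hu
    have h3 := hD.theta_mem i hi p
    have h4 : 0 < Real.cos (θ i p) :=
      Real.cos_pos_of_mem_Ioo ⟨by linarith [h3.1, Real.pi_pos], lt_of_le_of_ne h3.2 hθ⟩
    rw [h, norm_zero, eq_comm, mul_eq_zero, or_iff_right h4.ne', norm_eq_zero] at h1
    exact h1

/-- `T` detects membership in a distribution if it is injective on the others. -/
lemma T_mem_iff {i : Fin (k + 1)} (hθ : ∀ j, j ≠ i → θ j p ≠ Real.pi / 2)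
    {u : TangentSpace 𝓘(ℝ, E) p} : f.T S p u ∈ D i p ↔ u ∈ D i p := by
  refine ⟨fun h ↦ ?_, hD.T_mem_of_mem⟩
  obtain ⟨w, hw, rfl⟩ := hD.exists_sum u
  rw [Finset.sum_eq_single i]
  · exact hw i
  · intro j _ hj
    refine hD.eq_zero_of_T_eq_zero (hθ j hj) (hw j) ?_
    refine hD.eq_zero_of_inner_sum_eq_zero (w := fun j ↦ f.T S p (w j))
      (fun j ↦ hD.T_mem_of_mem (hw j)) fun v hv ↦ ?_
    rw [← map_sum]
    exact hD.orthogonal j i hj p v hv _ h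
  · simp

end IsPointwiseSlant

variable (f S p) in
/-- The normal vectors which `φ` maps to normal vectors. -/
def invariantNormalSpace : Submodule ℝ (TangentSpace 𝓘(ℝ, E') (f.toFun p)) :=
  f.normalSpace p ⊓ (f.normalSpace p).comap (S.φ (f.toFun p)).toLinearMap

lemma n_n_of_mem {V : f.normalSpace p} (hV : S.φ (f.toFun p) V ∈ f.normalSpace p) :
    (f.n S p ^ 2) V = (-1 : ℝ) • V := by
  have h1 : ((f.n S p V : f.normalSpace p) : TangentSpace 𝓘(ℝ, E') (f.toFun p)) =
      S.φ (f.toFun p) V := f.coe_normalPart_of_mem_normalSpace hV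
  have h2 : ((f.n S p (f.n S p V) : f.normalSpace p) : TangentSpace 𝓘(ℝ, E') (f.toFun p)) =
      f.normalPart p (S.φ (f.toFun p) (f.n S p V : f.normalSpace p)) := rfl
  rw [pow_two, Module.End.mul_apply]
  apply Subtype.ext
  rw [h2, h1, S.sq, f.coe_normalPart_of_mem_normalSpace (neg_mem V.2)]
  simp

lemma hasEigenvector_n_sq {V : f.normalSpace p} (hV : S.φ (f.toFun p) V ∈ f.normalSpace p)
    (hV0 : V ≠ 0) : Module.End.HasEigenvector (f.n S p ^ 2) (-1) V :=
  Module.End.hasEigenvector_iff.2 ⟨Module.End.mem_eigenspace_iff.2 (n_n_of_mem hV), hV0⟩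

/-- The space of normal vectors mapped to normal vectors by `φ` has dimension
`dim N - 2 dim M + rank D₀`. -/
lemma IsPointwiseSlant.finrank_invariantNormalSpace {k : ℕ}
    {D : Fin (k + 1) → TangentDistribution 𝓘(ℝ, E) M} {θ : Fin (k + 1) → M → ℝ}
    (hD : f.IsPointwiseSlant S k D θ) (p : M) :
    Module.finrank ℝ (f.invariantNormalSpace S p) + 2 * Module.finrank ℝ E =
      Module.finrank ℝ E' + Module.finrank ℝ (D 0 p) := by
  let A := f.tangentImage p
  let B := A.map (S.φ (f.toFun p)).toLinearMap
  have hφ : Function.Injective (S.φ (f.toFun p)) := fun v w h ↦ by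
    have := congrArg (S.φ (f.toFun p)) h
    rwa [S.sq, S.sq, neg_inj] at this
  have h1 : f.invariantNormalSpace S p = (A ⊔ B)ᗮ := by
    rw [← Submodule.inf_orthogonal]
    ext w
    refine and_congr Iff.rfl ?_
    change S.φ (f.toFun p) w ∈ Aᗮ ↔ w ∈ Bᗮ
    rw [Submodule.mem_orthogonal', Submodule.mem_orthogonal']
    constructor
    · rintro h _ ⟨u, hu, rfl⟩
      have := h u hu
      rw [S.inner_φ_left, neg_eq_zero] at this
      exact this
    · intro h u hu
      rw [S.inner_φ_left, neg_eq_zero]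
      exact h _ ⟨u, hu, rfl⟩
  have h2 : A ⊓ B = (D 0 p).map (f.d p).toLinearMap := by
    ext w
    constructor
    · rintro ⟨⟨u, rfl⟩, ⟨_, ⟨v, rfl⟩, hv⟩⟩
      refine ⟨u, (hD.mem_zero_iff).2 ?_, rfl⟩
      have hv' : S.φ (f.toFun p) (f.d p v) = f.d p u := hv
      have hu : S.φ (f.toFun p) (f.d p u) = f.d p (-v) := by rw [← hv', S.sq, map_neg]
      rw [T_apply u, hu, tangentialPart_d, T_apply, map_neg, map_neg, hv', map_neg,
        tangentialPart_d]
    · rintro ⟨u, hu, rfl⟩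
      refine ⟨⟨u, rfl⟩, ⟨f.d p (-f.T S p u), ⟨_, rfl⟩, ?_⟩⟩
      change S.φ (f.toFun p) (f.d p (-f.T S p u)) = f.d p u
      rw [map_neg, map_neg, hD.φ_d_of_mem (hD.T_mem_of_mem hu), hD.T_T_of_mem hu, map_neg, neg_neg]
  have hA : Module.finrank ℝ A = Module.finrank ℝ E :=
    LinearMap.finrank_range_of_inj (f := (f.d p).toLinearMap) (f.d p).injective
  have hB : Module.finrank ℝ B = Module.finrank ℝ A :=
    (A.equivMapOfInjective (S.φ (f.toFun p)).toLinearMap hφ).finrank_eq.symm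
  have hAB : Module.finrank ℝ ((D 0 p).map (f.d p).toLinearMap) = Module.finrank ℝ (D 0 p) :=
    ((D 0 p).equivMapOfInjective (f.d p).toLinearMap (f.d p).injective).finrank_eq.symm
  have h3 := Submodule.finrank_sup_add_finrank_inf_eq A B
  have h4 := (A ⊔ B).finrank_add_finrank_orthogonal
  have h5 : Module.finrank ℝ (TangentSpace 𝓘(ℝ, E') (f.toFun p)) = Module.finrank ℝ E' := rfl
  rw [h2, hAB, hB, hA] at h3
  rw [h1]
  omega

end RiemannianSubmanifold
end PointwiseSlant
end Slant

namespace Slant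

section PointwiseSlant
variable {E : Type*} [NormedAddCommGroup E] [NormedSpace ℝ E] [FiniteDimensional ℝ E]
  {M : Type*} [TopologicalSpace M] [ChartedSpace E M] [IsManifold 𝓘(ℝ, E) ∞ M]
  [RiemannianBundle (fun x : M ↦ TangentSpace 𝓘(ℝ, E) x)]
  [IsContMDiffRiemannianBundle 𝓘(ℝ, E) ∞ E (fun x : M ↦ TangentSpace 𝓘(ℝ, E) x)]
  {E' : Type*} [NormedAddCommGroup E'] [NormedSpace ℝ E'] [FiniteDimensional ℝ E']
  {N : Type*} [TopologicalSpace N] [ChartedSpace E' N] [IsManifold 𝓘(ℝ, E') ∞ N]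
  [RiemannianBundle (fun x : N ↦ TangentSpace 𝓘(ℝ, E') x)]
  [IsContMDiffRiemannianBundle 𝓘(ℝ, E') ∞ E' (fun x : N ↦ TangentSpace 𝓘(ℝ, E') x)]
  {f : RiemannianSubmanifold 𝓘(ℝ, E) M 𝓘(ℝ, E') N}
  {S : AlmostHermitianStructure 𝓘(ℝ, E') N}
  {k : ℕ} {D : Fin (k + 1) → TangentDistribution 𝓘(ℝ, E) M} {θ : Fin (k + 1) → M → ℝ}

namespace RiemannianSubmanifold.IsPointwiseSlant

lemma T_mem_sections (hD : f.IsPointwiseSlant S k D θ) {Y : Π q : M, TangentSpace 𝓘(ℝ, E) q}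
    (hY : Y ∈ (D 0).sections) : (fun q ↦ f.T S q (Y q)) ∈ (D 0).sections := by
  refine ⟨f.isSmoothVectorField_of_d ?_, fun q ↦ hD.T_mem_of_mem (hY.2 q)⟩
  simp only [← hD.φ_d_of_mem (hY.2 _)]
  exact S.contMDiff_along f.contMDiff_toFun
    ((f.contMDiff_toFun.contMDiff_tangentMap (m := ∞) (by simp)).comp hY.1)

lemma leviCivita_mem (hD : f.IsPointwiseSlant S k D θ) (hT : f.IsParallelT S)
    {X Y : Π q : M, TangentSpace 𝓘(ℝ, E) q} (hX : IsSmoothVectorField 𝓘(ℝ, E) X)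
    (hY : Y ∈ (D 0).sections) (p : M) : leviCivita 𝓘(ℝ, E) M Y p (X p) ∈ D 0 p := by
  rw [hD.mem_zero_iff, ← hT X Y hX hY.1, ← hT X _ hX (hD.T_mem_sections hY).1]
  have h1 : (fun q ↦ f.T S q (f.T S q (Y q))) = (-1 : ℝ) • Y := by
    ext q
    simp [hD.T_T_of_mem (hY.2 q)]
  rw [h1, (leviCivita 𝓘(ℝ, E) M).isCovariantDerivativeOnUniv.smul_const _ (hY.1.mdiffAt p)]
  simp

lemma isCompletelyIntegrable_zero (hD : f.IsPointwiseSlant S k D θ) (hT : f.IsParallelT S) :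
    (D 0).IsCompletelyIntegrable :=
  fun _ hX _ hY p ↦ hD.leviCivita_mem hT hX.1 hY p

lemma isCompletelyIntegrable_iSup_succ [T2Space M] (hD : f.IsPointwiseSlant S k D θ)
    (hT : f.IsParallelT S) :
    TangentDistribution.IsCompletelyIntegrable (fun p ↦ ⨆ i : Fin k, D i.succ p) := by
  intro X hX Y hY p
  refine hD.mem_iSup_succ_iff.2 fun z hz ↦ ?_
  obtain ⟨Z, hZ, rfl⟩ := (hD.smooth_regular 0).exists_section hz
  have h := leviCivita_metric (hX.1.mdiffAt p) (hZ.1.mdiffAt p) (hY.1.mdiffAt p)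
  have h1 : (fun q ↦ inner ℝ (Z q) (Y q)) = fun _ ↦ (0 : ℝ) := by
    ext q
    exact hD.mem_iSup_succ_iff.1 (hY.2 q) _ (hZ.2 q)
  rw [h1, mvfderiv_const, hD.mem_iSup_succ_iff.1 (hY.2 p) _ (hD.leviCivita_mem hT hX.1 hZ p)] at h
  simpa using h.symm

lemma isIntegrable_iff (hD : f.IsPointwiseSlant S k D θ) (hT : f.IsParallelT S)
    {i : Fin (k + 1)} (hθ : ∀ j, j ≠ i → ∀ p, θ j p ≠ Real.pi / 2) :
    (D i).IsIntegrable ↔ ∀ X ∈ (D i).sections, ∀ Y ∈ (D i).sections, ∀ p,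
      leviCivita 𝓘(ℝ, E) M (fun q ↦ f.T S q (Y q)) p (X p)
        - leviCivita 𝓘(ℝ, E) M (fun q ↦ f.T S q (X q)) p (Y p) ∈ D i p := by
  have := FiniteDimensional.complete ℝ E
  refine forall₂_congr fun X hX ↦ forall₂_congr fun Y hY ↦ forall_congr' fun p ↦ ?_
  rw [hT X Y hX.1 hY.1, hT Y X hY.1 hX.1, ← map_sub,
    (CovariantDerivative.torsion_eq_zero_iff _).1 (leviCivita_torsion (I := 𝓘(ℝ, E)) (M := M))
      (hX.1.mdiffAt p) (hY.1.mdiffAt p), hD.T_mem_iff fun j hj ↦ hθ j hj p]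

/-- On the invariant distribution, `φ (h(X, Y)) = h(X, TY)`. -/
lemma φ_h [T2Space N] (hS : S.IsKahler) (hD : f.IsPointwiseSlant S k D θ) (hT : f.IsParallelT S)
    {X Y : Π q : M, TangentSpace 𝓘(ℝ, E) q} (hX : IsSmoothVectorField 𝓘(ℝ, E) X)
    (hY : Y ∈ (D 0).sections) (p : M) :
    S.φ (f.toFun p) (f.h X Y p) = f.h X (fun q ↦ f.T S q (Y q)) p := by
  have h1 := hS.covAlong_φ (f.mdifferentiableAt_toFun p) (f.mdiffAlongAt_d (hY.1.mdiffAt p)) (X p)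
  simp only [hD.φ_d_of_mem (hY.2 _)] at h1
  rw [f.covAlong_d (hX.mdiffAt p) (hY.1.mdiffAt p),
    f.covAlong_d (Y := fun q ↦ f.T S q (Y q)) (hX.mdiffAt p) ((hD.T_mem_sections hY).1.mdiffAt p),
    hT X Y hX hY.1, map_add, hD.φ_d_of_mem (hD.leviCivita_mem hT hX hY p)] at h1
  exact (add_left_cancel h1).symm

lemma h_mem_invariantNormalSpace [T2Space N] (hS : S.IsKahler) (hD : f.IsPointwiseSlant S k D θ)
    (hT : f.IsParallelT S) {X Y : Π q : M, TangentSpace 𝓘(ℝ, E) q}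
    (hX : IsSmoothVectorField 𝓘(ℝ, E) X) (hY : Y ∈ (D 0).sections) (p : M) :
    (f.h X Y p : TangentSpace 𝓘(ℝ, E') (f.toFun p)) ∈ f.invariantNormalSpace S p := by
  refine ⟨(f.h X Y p).2, ?_⟩
  change S.φ (f.toFun p) (f.h X Y p) ∈ f.normalSpace p
  rw [hD.φ_h hS hT hX hY p]
  exact (f.h X _ p).2

/-- The eigenvalue `-1` of `n²` occurs everywhere if some point carries a nonzero normal vector
which `φ` maps to a normal vector. -/
lemma hasEigenvalue_n_sq (hD : f.IsPointwiseSlant S k D θ) {p : M}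
    (hp : f.invariantNormalSpace S p ≠ ⊥) (q : M) :
    Module.End.HasEigenvalue (f.n S q ^ 2) (-1) := by
  obtain ⟨r, hr⟩ := (hD.smooth_regular 0).exists_finrank_eq
  have h1 := hD.finrank_invariantNormalSpace p
  have h2 := hD.finrank_invariantNormalSpace q
  rw [hr] at h1 h2
  have h3 : f.invariantNormalSpace S q ≠ ⊥ := by
    rw [← Submodule.one_le_finrank_iff] at hp ⊢
    omega
  obtain ⟨V, hV, hV0⟩ := Submodule.exists_mem_ne_zero_of_ne_bot h3
  exact Module.End.hasEigenvalue_of_hasEigenvector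
    (hasEigenvector_n_sq (V := ⟨V, hV.1⟩) hV.2 fun h ↦ hV0 (congrArg Subtype.val h))

lemma h_eq_zero_or_hasEigenvalue [T2Space N] (hS : S.IsKahler) (hD : f.IsPointwiseSlant S k D θ)
    (hT : f.IsParallelT S) :
    (∀ X ∈ (D 0).sections, ∀ Y ∈ (D 0).sections, ∀ p, f.h X Y p = 0) ∨
      (∀ p, Module.End.HasEigenvalue (f.n S p ^ 2) (-1)) ∧
        ∀ X ∈ (D 0).sections, ∀ Y ∈ (D 0).sections, ∀ p, f.h X Y p ≠ 0 →
          Module.End.HasEigenvector (f.n S p ^ 2) (-1) (f.h X Y p) := by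
  refine or_iff_not_imp_left.2 fun hne ↦ ⟨?_, fun X hX Y hY p hp ↦
    hasEigenvector_n_sq (hD.h_mem_invariantNormalSpace hS hT hX.1 hY p).2 hp⟩
  push Not at hne
  obtain ⟨X, hX, Y, hY, p, hp⟩ := hne
  refine hD.hasEigenvalue_n_sq (p := p) fun hbot ↦ hp ?_
  have h := hD.h_mem_invariantNormalSpace hS hT hX.1 hY p
  rw [hbot, Submodule.mem_bot] at h
  exact Subtype.ext h

end RiemannianSubmanifold.IsPointwiseSlant
end PointwiseSlant
end Slant

end

open Slant
theorem theorem3p5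
    {E : Type*} [NormedAddCommGroup E] [NormedSpace ℝ E] [FiniteDimensional ℝ E]
    {M : Type*} [TopologicalSpace M] [T2Space M] [SecondCountableTopology M]
    [ChartedSpace E M] [IsManifold 𝓘(ℝ, E) ∞ M]
    [RiemannianBundle (fun x : M ↦ TangentSpace 𝓘(ℝ, E) x)]
    [IsContMDiffRiemannianBundle 𝓘(ℝ, E) ∞ E (fun x : M ↦ TangentSpace 𝓘(ℝ, E) x)]
    {E' : Type*} [NormedAddCommGroup E'] [NormedSpace ℝ E'] [FiniteDimensional ℝ E']
    {N : Type*} [TopologicalSpace N] [T2Space N] [SecondCountableTopology N]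
    [ChartedSpace E' N] [IsManifold 𝓘(ℝ, E') ∞ N]
    [RiemannianBundle (fun x : N ↦ TangentSpace 𝓘(ℝ, E') x)]
    [IsContMDiffRiemannianBundle 𝓘(ℝ, E') ∞ E' (fun x : N ↦ TangentSpace 𝓘(ℝ, E') x)]
    (S : AlmostHermitianStructure 𝓘(ℝ, E') N) (hS : S.IsKahler)
    (f : RiemannianSubmanifold 𝓘(ℝ, E) M 𝓘(ℝ, E') N)
    (k : ℕ) (D : Fin (k + 1) → TangentDistribution 𝓘(ℝ, E) M) (θ : Fin (k + 1) → M → ℝ)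
    (hD : f.IsPointwiseSlant S k D θ) (hT : f.IsParallelT S) :
    ((D 0).IsCompletelyIntegrable ∧
      TangentDistribution.IsCompletelyIntegrable (fun p ↦ ⨆ i : Fin k, D i.succ p)) ∧
    (∀ i : Fin (k + 1), (∀ j, j ≠ i → ∀ p, θ j p ≠ Real.pi / 2) →
      ((D i).IsIntegrable ↔ ∀ X ∈ (D i).sections, ∀ Y ∈ (D i).sections, ∀ p,
        leviCivita 𝓘(ℝ, E) M (fun q ↦ f.T S q (Y q)) p (X p)
          - leviCivita 𝓘(ℝ, E) M (fun q ↦ f.T S q (X q)) p (Y p) ∈ D i p)) ∧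
    ((∀ X ∈ (D 0).sections, ∀ Y ∈ (D 0).sections, ∀ p, f.h X Y p = 0) ∨
      (∀ p, Module.End.HasEigenvalue (f.n S p ^ 2) (-1)) ∧
        ∀ X ∈ (D 0).sections, ∀ Y ∈ (D 0).sections, ∀ p, f.h X Y p ≠ 0 →
          Module.End.HasEigenvector (f.n S p ^ 2) (-1) (f.h X Y p)) :=
  ⟨⟨hD.isCompletelyIntegrable_zero hT, hD.isCompletelyIntegrable_iSup_succ hT⟩,
    fun _ hθ ↦ hD.isIntegrable_iff hT hθ, hD.h_eq_zero_or_hasEigenvalue hS hT⟩
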